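/- For $q\in\mathbb C$, $|q|<1$, let $$\Theta(q,x)=\sum_{j\ge 0}q^{j(j+1)/2}x^j\quad(x\in\mathbb C),\qquad H_N(q,u)=\sum_{s=-N}^{\infty}(-1)^sq^{s(s+1)/2}e^{su}\quad(q\neq0,\ u\in\mathbb C,\ N\ge 1),$$ and let $$\operatorname{Spec}(\Theta)=\{q\in\mathbb C:\ |q|<1\text{ and there is }x\in\mathbb C\text{ with }\Theta(q,x)=\partial_x\Theta(q,x)=0\}.$$ **Theorem (Root-of-unity lifting).** Let $\omega\in\mathbb C$ be a root of unity, primitive of order $b\ge1$. There are an infinite arithmetic progression of positive integers and complex numbers $\tau_N,v_N$, for $N$ in this progression, such that, as $N\to\infty$ in the progression, $$\tau_N=\frac{\pi}{b}+O\!\left(\frac{\log N}{N}\right),\qquad v_N=\frac{3\pi}{4}+o(1),$$ and such that, with $$q_N=\omega e^{-\tau_N/N},\qquad u_N=\frac{v_N}{N},\qquad x_N=-q_N^{-N}e^{u_N},$$ the following holds: $q_N\to\omega$, and, for all sufficiently large $N$ in the progression, $|q_N|<1$, $$H_N(q_N,u_N)=\partial_uH_N(q_N,u_N)=0,$$ and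 $x_N$ is a multiple zero of $\Theta(q_N,\cdot)$, that is, $\Theta(q_N,x_N)=\partial_x\Theta(q_N,x_N)=0$; in particular $q_N\in\operatorname{Spec}(\Theta)$. -/

import Mathlib

open Filter Topology Asymptotics

/-- The partial theta function `Θ(q, x) = ∑_{j ≥ 0} q^{j(j+1)/2} x^j`, for `|q| < 1`. -/
noncomputable def partialTheta (q x : ℂ) : ℂ :=
  ∑' j : ℕ, q ^ (j * (j + 1) / 2) * x ^ j

/-- The point `x` is a multiple zero of `Θ(q, ·)`, that is, `Θ(q, x) = ∂ₓΘ(q, x) = 0`. -/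
def IsMultipleZero (q x : ℂ) : Prop :=
  partialTheta q x = 0 ∧ HasDerivAt (fun y : ℂ => partialTheta q y) 0 x

/-- The complex spectrum `Spec(Θ)`: all `q` in the open unit disk for which `Θ(q, ·)` has a
multiple zero. -/
def thetaSpec : Set ℂ :=
  {q : ℂ | ‖q‖ < 1 ∧ ∃ x : ℂ, IsMultipleZero q x}

/-- The term `(-1)^s q^{s(s+1)/2} e^{su}`, for an integer `s`; the product `s(s+1)` is even, so
the integer division is exact. -/
noncomputable def windowTerm (q u : ℂ) (s : ℤ) : ℂ :=
  (-1) ^ s * q ^ (s * (s + 1) / 2) * Complex.exp (s * u)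

/-- The function `H_N(q, u) = ∑_{s ≥ -N} (-1)^s q^{s(s+1)/2} e^{su}`, for `|q| < 1`; the index
`s ≥ -N` is written as `s = k - N` with `k ≥ 0`. -/
noncomputable def windowH (N : ℕ) (q u : ℂ) : ℂ :=
  ∑' k : ℕ, windowTerm q u ((k : ℤ) - (N : ℤ))

/-- The series that defines `Θ(q, x)` converges absolutely for `|q| < 1`. -/
theorem summable_partialTheta {q : ℂ} (hq : ‖q‖ < 1) (x : ℂ) :
    Summable fun j : ℕ => q ^ (j * (j + 1) / 2) * x ^ j := by
  have hlim : Tendsto (fun j : ℕ => ‖q‖ ^ (j + 1) * ‖x‖) atTop (𝓝 0) := by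
    have h := ((tendsto_pow_atTop_nhds_zero_of_lt_one (norm_nonneg q) hq).comp
      (tendsto_add_atTop_nat 1)).mul_const ‖x‖
    simpa using h
  refine summable_of_ratio_norm_eventually_le (r := 1 / 2) (by norm_num) ?_
  filter_upwards [hlim.eventually (ge_mem_nhds (show (0 : ℝ) < 1 / 2 by norm_num))] with j hj
  have he : (j + 1) * (j + 1 + 1) / 2 = j * (j + 1) / 2 + (j + 1) := by
    rw [show (j + 1) * (j + 1 + 1) = j * (j + 1) + (j + 1) * 2 by ring,
      Nat.add_mul_div_right _ _ (by norm_num)]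
  have hs : q ^ ((j + 1) * (j + 1 + 1) / 2) * x ^ (j + 1)
      = (q ^ (j + 1) * x) * (q ^ (j * (j + 1) / 2) * x ^ j) := by
    rw [he]; ring
  rw [hs, norm_mul]
  refine mul_le_mul_of_nonneg_right ?_ (norm_nonneg _)
  simpa [norm_mul, norm_pow] using hj

/-- The series that defines `H_N(q, u)` converges absolutely for `|q| < 1`. -/
theorem summable_windowH {q : ℂ} (hq : ‖q‖ < 1) (N : ℕ) (u : ℂ) :
    Summable fun k : ℕ => windowTerm q u ((k : ℤ) - (N : ℤ)) := by
  rw [← summable_nat_add_iff N]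
  refine (summable_partialTheta hq (-Complex.exp u)).congr fun j => ?_
  have h1 : (((j + N : ℕ) : ℤ) - (N : ℤ)) = (j : ℤ) := by push_cast; ring
  have h2 : ((j : ℤ) * ((j : ℤ) + 1) / 2) = ((j * (j + 1) / 2 : ℕ) : ℤ) := by push_cast; rfl
  rw [h1]
  unfold windowTerm
  rw [h2, zpow_natCast, zpow_natCast, neg_pow, ← Complex.exp_nat_mul]
  push_cast
  ring

/-! With `q = ω e^{-τ/N}` and `u = v/N`, the function `H_N` is a two-sided theta series minus its
tail over `s < -N`. Both pieces are exponentially small, at rates that can be made to agree.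

The phase `(-1)^s ω^{s(s+1)/2}` is antiperiodic mod `b`, so Poisson summation over each residue
class leaves only odd frequencies (`tsum_scaledTerm_residue`). The pair `±1` dominates; by the
symmetry `s ↦ -1-s` it combines into a Gauss sum times `sin v` (`sum_quadPhase_mul_two_exp`), of
size about `√N exp(-π²N/(2τb²))`. The tail is governed by its edge `s = -N-1` and has size about
`exp(-τN/2)`. The exponents coincide at `τ = π/b`, and the correction `τ = π/b + (s - (log N)/2)/N`
absorbs the `√N`. The normalised `H_N` then tends to `κ sin v - μ e^{-s-v}`, uniformly on compact
sets (`tendsto_windowH_mul_normalizer`).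

Here `κ ≠ 0` because the Gauss sum does not vanish (`gaussPhaseSum_ne_zero`). The constant `μ`
depends on `N` mod `2b` and is nonzero for some class (`exists_tailLimit_ne_zero`); that class is
the progression. Since `sin = -cos ≠ 0` at `3π/4`, the limit has a nondegenerate double zero there
for a suitable `s`, and it persists for large `N` (`exists_tendsto_double_zero`). Finally, `x =
-q^{-N}e^u` turns `Θ` into `H_N` times a nonvanishing factor (`partialTheta_eq_mul_windowH`). -/

/-! ### Persistence of nondegenerate double zeros -/

/-- Cauchy's estimate on a disc of half the radius. -/
theorem norm_deriv_le_of_norm_le_ball {f : ℂ → ℂ} {c : ℂ} {R η : ℝ} (hR : 0 < R)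
    (hf : DifferentiableOn ℂ f (Metric.ball c R)) (hη : ∀ z ∈ Metric.ball c R, ‖f z‖ ≤ η)
    {x : ℂ} (hx : x ∈ Metric.ball c (R / 2)) : ‖deriv f x‖ ≤ 4 * η / R := by
  have hsub : Metric.closedBall x (R / 4) ⊆ Metric.ball c R := by
    refine Metric.closedBall_subset_ball' ?_
    have := Metric.mem_ball.1 hx
    linarith
  have h := Complex.norm_deriv_le_of_forall_mem_sphere_norm_le (c := x) (R := R / 4) (C := η)
    (f := f) (by positivity)
    ((hf.mono hsub).diffContOnCl_ball subset_rfl)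
    (fun z hz => hη z (hsub (Metric.sphere_subset_closedBall hz)))
  calc _ ≤ η / (R / 4) := h
    _ = _ := by field_simp

/-- A bounded holomorphic function is Lipschitz on a disc of half the radius. -/
theorem norm_sub_le_of_norm_le_ball {f : ℂ → ℂ} {c : ℂ} {R η : ℝ} (hR : 0 < R)
    (hf : DifferentiableOn ℂ f (Metric.ball c R)) (hη : ∀ z ∈ Metric.ball c R, ‖f z‖ ≤ η)
    {x y : ℂ} (hx : x ∈ Metric.ball c (R / 2)) (hy : y ∈ Metric.ball c (R / 2)) :
    ‖f x - f y‖ ≤ 4 * η / R * ‖x - y‖ := by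
  refine Convex.norm_image_sub_le_of_norm_deriv_le (s := Metric.ball c (R / 2)) (fun z hz => ?_)
    (fun z hz => norm_deriv_le_of_norm_le_ball hR hf hη hz) (convex_ball _ _) hy hx
  exact hf.differentiableAt
    (Metric.isOpen_ball.mem_nhds (Metric.ball_subset_ball (by linarith) hz))

/-- A bounded, separately holomorphic function on a bidisc is, together with its derivative in
the second variable, Lipschitz on a smaller bidisc. -/
theorem approximatesLinearOn_zero_of_norm_le {f : ℂ → ℂ → ℂ} {a c : ℂ} {R η : ℝ}
    (hR : 0 < R) (hη : 0 ≤ η)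
    (h1 : ∀ v ∈ Metric.ball c R, DifferentiableOn ℂ (fun s => f s v) (Metric.ball a R))
    (h2 : ∀ s ∈ Metric.ball a R, DifferentiableOn ℂ (f s) (Metric.ball c R))
    (hb : ∀ s ∈ Metric.ball a R, ∀ v ∈ Metric.ball c R, ‖f s v‖ ≤ η)
    {x y : ℂ × ℂ} (hx : x ∈ Metric.ball (a, c) (R / 4)) (hy : y ∈ Metric.ball (a, c) (R / 4)) :
    ‖((f x.1 x.2, deriv (f x.1) x.2) - (f y.1 y.2, deriv (f y.1) y.2) : ℂ × ℂ)‖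
      ≤ (8 * η / R + 64 * η / R ^ 2) * ‖x - y‖ := by
  rw [← ball_prod_same] at hx hy
  obtain ⟨hx1, hx2⟩ := hx
  obtain ⟨hy1, hy2⟩ := hy
  have s4 : ∀ c : ℂ, Metric.ball c (R / 4) ⊆ Metric.ball c R :=
    fun c => Metric.ball_subset_ball (by linarith)
  have s42 : ∀ c : ℂ, Metric.ball c (R / 4) ⊆ Metric.ball c (R / 2) :=
    fun c => Metric.ball_subset_ball (by linarith)
  have s2 : ∀ c : ℂ, Metric.ball c (R / 2) ⊆ Metric.ball c R :=
    fun c => Metric.ball_subset_ball (by linarith)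
  have e4 : R / 4 = R / 2 / 2 := by ring
  have n1 : ‖x.1 - y.1‖ ≤ ‖x - y‖ := norm_fst_le (x - y)
  have n2 : ‖x.2 - y.2‖ ≤ ‖x - y‖ := norm_snd_le (x - y)
  have hs : ∀ v ∈ Metric.ball c R, ‖f x.1 v - f y.1 v‖ ≤ 4 * η / R * ‖x.1 - y.1‖ := fun v hv =>
    norm_sub_le_of_norm_le_ball hR (h1 v hv) (fun s hs => hb s hs v hv) (s42 _ hx1) (s42 _ hy1)
  have A : ‖f x.1 x.2 - f y.1 y.2‖ ≤ 8 * η / R * ‖x - y‖ := by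
    have h3 := hs x.2 (s4 _ hx2)
    have h4 := norm_sub_le_of_norm_le_ball hR (h2 y.1 (s4 _ hy1)) (hb y.1 (s4 _ hy1))
      (s42 _ hx2) (s42 _ hy2)
    calc ‖f x.1 x.2 - f y.1 y.2‖ ≤ ‖f x.1 x.2 - f y.1 x.2‖ + ‖f y.1 x.2 - f y.1 y.2‖ :=
          norm_sub_le_norm_sub_add_norm_sub _ _ _
      _ ≤ 4 * η / R * ‖x - y‖ + 4 * η / R * ‖x - y‖ := by
          refine add_le_add (h3.trans ?_) (h4.trans ?_) <;> gcongr
      _ = _ := by ring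
  have B : ‖deriv (f x.1) x.2 - deriv (f y.1) y.2‖ ≤ 64 * η / R ^ 2 * ‖x - y‖ := by
    have hd : ∀ s ∈ Metric.ball a R, ∀ v ∈ Metric.ball c R, DifferentiableAt ℂ (f s) v :=
      fun s hs v hv => (h2 s hs).differentiableAt (Metric.isOpen_ball.mem_nhds hv)
    -- The difference of two slices is holomorphic in the second variable and bounded by a multiple
    -- of `‖x.1 - y.1‖`, so Cauchy's estimate passes this bound to its derivative.
    have h3 : ‖deriv (f x.1) x.2 - deriv (f y.1) x.2‖ ≤ 4 * (4 * η / R * ‖x.1 - y.1‖) / R := by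
      rw [← deriv_fun_sub (hd _ (s4 _ hx1) _ (s4 _ hx2)) (hd _ (s4 _ hy1) _ (s4 _ hx2))]
      exact norm_deriv_le_of_norm_le_ball hR ((h2 _ (s4 _ hx1)).sub (h2 _ (s4 _ hy1))) hs
        (s42 _ hx2)
    have h4 : ‖deriv (f y.1) x.2 - deriv (f y.1) y.2‖
        ≤ 4 * (4 * η / R) / (R / 2) * ‖x.2 - y.2‖ := by
      refine norm_sub_le_of_norm_le_ball (c := c) (by positivity : 0 < R / 2)
        (((h2 y.1 (s4 _ hy1)).deriv Metric.isOpen_ball).mono (s2 c)) (fun v hv => ?_)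
        (e4 ▸ hx2) (e4 ▸ hy2)
      exact norm_deriv_le_of_norm_le_ball hR (h2 y.1 (s4 _ hy1)) (hb y.1 (s4 _ hy1)) hv
    calc _ ≤ ‖deriv (f x.1) x.2 - deriv (f y.1) x.2‖
          + ‖deriv (f y.1) x.2 - deriv (f y.1) y.2‖ := norm_sub_le_norm_sub_add_norm_sub _ _ _
      _ ≤ 4 * (4 * η / R * ‖x - y‖) / R + 4 * (4 * η / R) / (R / 2) * ‖x - y‖ := by
          refine add_le_add (h3.trans ?_) (h4.trans ?_) <;> gcongr
      _ = 48 * η / R ^ 2 * ‖x - y‖ := by field_simp; ring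
      _ ≤ _ := by gcongr; norm_num
  refine (norm_prod_le_iff).2 ⟨A.trans ?_, B.trans ?_⟩
  · gcongr; linarith [show 0 ≤ 64 * η / R ^ 2 by positivity]
  · gcongr; linarith [show 0 ≤ 8 * η / R by positivity]

/-- Stability of a nondegenerate double zero under uniform limits of separately holomorphic
functions. -/
theorem exists_tendsto_double_zero {ι : Type*} {l : Filter ι} {F : ι → ℂ → ℂ → ℂ}
    {Φ : ℂ → ℂ → ℂ} {a c : ℂ} {R : ℝ} (hR : 0 < R)
    (h1 : ∀ᶠ N in l, ∀ v ∈ Metric.ball c R,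
      DifferentiableOn ℂ (fun s => F N s v) (Metric.ball a R))
    (h2 : ∀ᶠ N in l, ∀ s ∈ Metric.ball a R, DifferentiableOn ℂ (F N s) (Metric.ball c R))
    (g1 : ∀ v, Differentiable ℂ (fun s => Φ s v)) (g2 : ∀ s, Differentiable ℂ (Φ s))
    (hu : TendstoUniformlyOn (fun N (p : ℂ × ℂ) => F N p.1 p.2) (fun p => Φ p.1 p.2) l
      (Metric.ball a R ×ˢ Metric.ball c R))
    {L : (ℂ × ℂ) ≃L[ℂ] (ℂ × ℂ)}
    (hL : HasStrictFDerivAt (fun p : ℂ × ℂ => (Φ p.1 p.2, deriv (Φ p.1) p.2))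
      (L : (ℂ × ℂ) →L[ℂ] (ℂ × ℂ)) (a, c))
    (hz : Φ a c = 0) (hz' : deriv (Φ a) c = 0) :
    ∃ p : ι → ℂ × ℂ, Tendsto p l (𝓝 (a, c)) ∧
      ∀ᶠ N in l, F N (p N).1 (p N).2 = 0 ∧ deriv (F N (p N).1) (p N).2 = 0 := by
  set Ψ : ℂ × ℂ → ℂ × ℂ := fun p => (Φ p.1 p.2, deriv (Φ p.1) p.2) with hΨ
  set G : ι → ℂ × ℂ → ℂ × ℂ := fun N p => (F N p.1 p.2, deriv (F N p.1) p.2) with hG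
  have hK : 0 < ‖(L.symm : (ℂ × ℂ) →L[ℂ] (ℂ × ℂ))‖₊ := L.nnnorm_symm_pos
  set K : NNReal := ‖(L.symm : (ℂ × ℂ) →L[ℂ] (ℂ × ℂ))‖₊ with hKdef
  have hκ : 0 < K⁻¹ / 4 := by positivity
  obtain ⟨S, hS, hLS⟩ := hL.approximates_deriv_on_nhds (Or.inr hκ)
  obtain ⟨r, hr, hrS⟩ := Metric.mem_nhds_iff.1 hS
  set ρ := min r (R / 4) with hρ
  have hρ0 : 0 < ρ := lt_min hr (by positivity)
  -- Uniform closeness of `F N` to `Φ` makes `G N - Ψ` small in the Lipschitz sense; as `Ψ` vanishes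
  -- at `(a, c)`, the value of `G N` there is small too.
  have key : ∀ η > 0, ∀ᶠ N in l, (∀ x ∈ Metric.ball (a, c) (R / 4),
      ∀ y ∈ Metric.ball (a, c) (R / 4), ‖(G N x - Ψ x) - (G N y - Ψ y)‖
        ≤ (8 * η / R + 64 * η / R ^ 2) * ‖x - y‖) ∧ ‖G N (a, c)‖ ≤ η + 4 * η / R := by
    intro η hη
    filter_upwards [h1, h2, Metric.tendstoUniformlyOn_iff.1 hu η hη] with N k1 k2 k3
    have hb : ∀ s ∈ Metric.ball a R, ∀ v ∈ Metric.ball c R, ‖F N s v - Φ s v‖ ≤ η := by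
      intro s hs v hv
      have := k3 (s, v) ⟨hs, hv⟩
      rw [dist_comm, dist_eq_norm] at this
      exact this.le
    have hd : ∀ p ∈ Metric.ball (a, c) R,
        G N p - Ψ p = (F N p.1 p.2 - Φ p.1 p.2, deriv (fun v => F N p.1 v - Φ p.1 v) p.2) := by
      intro p hp
      rw [← ball_prod_same] at hp
      rw [deriv_fun_sub ((k2 _ hp.1).differentiableAt (Metric.isOpen_ball.mem_nhds hp.2))
        (g2 _ _)]
      rfl
    constructor
    · intro x hx y hy
      have sub : Metric.ball (a, c) (R / 4) ⊆ Metric.ball (a, c) R :=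
        Metric.ball_subset_ball (by linarith)
      rw [hd x (sub hx), hd y (sub hy)]
      exact approximatesLinearOn_zero_of_norm_le (f := fun s v => F N s v - Φ s v) hR hη.le
        (fun v hv => (k1 v hv).sub (g1 v).differentiableOn)
        (fun s hs => (k2 s hs).sub (g2 s).differentiableOn) hb hx hy
    · have h0 : G N (a, c) = G N (a, c) - Ψ (a, c) := by
        rw [show Ψ (a, c) = 0 from Prod.ext hz hz', sub_zero]
      rw [h0, hd _ (Metric.mem_ball_self hR)]
      have ha := Metric.mem_ball_self (x := a) hR
      have hc := Metric.mem_ball_self (x := c) hR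
      have q1 := hb a ha c hc
      have q2 := norm_deriv_le_of_norm_le_ball hR ((k2 a ha).sub (g2 a).differentiableOn)
        (hb a ha) (Metric.mem_ball_self (x := c) (by positivity : 0 < R / 2))
      have : 0 ≤ 4 * η / R := by positivity
      exact norm_prod_le_iff.2 ⟨by simpa using q1.trans (by linarith), q2.trans (by linarith)⟩
  have hG0 : Tendsto (fun N => ‖G N (a, c)‖) l (𝓝 0) := by
    rw [Metric.tendsto_nhds]
    intro ε hε
    filter_upwards [key (ε / (2 * (1 + 4 / R))) (by positivity)] with N hN
    rw [Real.dist_0_eq_abs, abs_of_nonneg (norm_nonneg _)]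
    refine hN.2.trans_lt ?_
    have : ε / (2 * (1 + 4 / R)) + 4 * (ε / (2 * (1 + 4 / R))) / R = ε / 2 := by
      field_simp
    rw [this]; linarith
  -- `G N` deviates from `L` by a Lipschitz constant `K⁻¹/2`: a quarter of `K⁻¹` from strict
  -- differentiability of `Ψ`, a quarter from `G N - Ψ`. What remains of `K⁻¹` is the expansion rate
  -- `m`, so a ball of radius `‖G N (a, c)‖ / m` has an image reaching `0`.
  set m : ℝ := (K : ℝ)⁻¹ / 2 with hm
  have hm0 : 0 < m := by positivity
  obtain ⟨η, hη, hηm⟩ : ∃ η > 0, 8 * η / R + 64 * η / R ^ 2 ≤ (K : ℝ)⁻¹ / 4 := by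
    refine ⟨(K : ℝ)⁻¹ / 4 / (8 / R + 64 / R ^ 2), by positivity, le_of_eq ?_⟩
    field_simp
  have hε0 : Tendsto (fun N => ‖G N (a, c)‖ / m) l (𝓝 0) := by simpa using hG0.div_const m
  have hex : ∀ᶠ N in l, ∃ p ∈ Metric.closedBall (a, c) (‖G N (a, c)‖ / m), G N p = 0 := by
    filter_upwards [key η hη, hε0.eventually_lt_const hρ0] with N hN hlt
    have hA : ApproximatesLinearOn (G N) (L : (ℂ × ℂ) →L[ℂ] (ℂ × ℂ)) (Metric.ball (a, c) ρ)
        (K⁻¹ / 2) := by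
      intro x hx y hy
      have b1 := hLS x (hrS (Metric.ball_subset_ball (min_le_left _ _) hx)) y
        (hrS (Metric.ball_subset_ball (min_le_left _ _) hy))
      have b2 := hN.1 x (Metric.ball_subset_ball (min_le_right _ _) hx) y
        (Metric.ball_subset_ball (min_le_right _ _) hy)
      have b3 : ‖(G N x - Ψ x) - (G N y - Ψ y)‖ ≤ (K : ℝ)⁻¹ / 4 * ‖x - y‖ :=
        b2.trans (by gcongr)
      calc ‖G N x - G N y - (L : (ℂ × ℂ) →L[ℂ] (ℂ × ℂ)) (x - y)‖
          = ‖(Ψ x - Ψ y - (L : (ℂ × ℂ) →L[ℂ] (ℂ × ℂ)) (x - y))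
            + ((G N x - Ψ x) - (G N y - Ψ y))‖ := by congr 1; abel
        _ ≤ _ := norm_add_le _ _
        _ ≤ ((K⁻¹ / 4 : NNReal) : ℝ) * ‖x - y‖ + (K : ℝ)⁻¹ / 4 * ‖x - y‖ := add_le_add b1 b3
        _ = _ := by push_cast; ring
    have hsurj := hA.surjOn_closedBall_of_nonlinearRightInverse
      L.toNonlinearRightInverse (b := (a, c)) (ε := ‖G N (a, c)‖ / m) (by positivity)
      (Metric.closedBall_subset_ball hlt)
    have hmem : (0 : ℂ × ℂ) ∈ Metric.closedBall (G N (a, c))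
        ((((L.toNonlinearRightInverse).nnnorm : ℝ)⁻¹ - ((K⁻¹ / 2 : NNReal) : ℝ))
          * (‖G N (a, c)‖ / m)) := by
      rw [Metric.mem_closedBall, dist_zero_left]
      have : ((L.toNonlinearRightInverse).nnnorm : ℝ) = K := rfl
      rw [this]
      push_cast
      rw [show (K : ℝ)⁻¹ - (K : ℝ)⁻¹ / 2 = m by rw [hm]; ring]
      rw [mul_div_cancel₀ _ hm0.ne']
    obtain ⟨p, hp, hp0⟩ := hsurj hmem
    exact ⟨p, hp, hp0⟩
  classical
  -- The default `(a, c)` satisfies the same distance bound, so convergence can be checked for every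
  -- `N`.
  refine ⟨fun N => if h : ∃ p ∈ Metric.closedBall (a, c) (‖G N (a, c)‖ / m), G N p = 0
    then h.choose else (a, c), ?_, ?_⟩
  · rw [tendsto_iff_dist_tendsto_zero]
    refine squeeze_zero (fun _ => dist_nonneg) (fun N => ?_) hε0
    split_ifs with h
    · exact h.choose_spec.1
    · rw [dist_self]; positivity
  · filter_upwards [hex] with N h
    rw [dif_pos h]
    exact Prod.ext_iff.1 h.choose_spec.2

/-! ### Quadratic phases and their Gauss sum -/

theorem Int.mul_succ_div_two_mul_two (s : ℤ) : s * (s + 1) / 2 * 2 = s * (s + 1) :=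
  Int.ediv_mul_cancel (Int.even_mul_succ_self s).two_dvd

/-- The quadratic phase `(-1)^s ω^{s(s+1)/2}`. -/
noncomputable def quadPhase (ω : ℂ) (s : ℤ) : ℂ :=
  (-1) ^ s * ω ^ (s * (s + 1) / 2)

theorem quadPhase_add {ω : ℂ} (hω : ω ≠ 0) (s t : ℤ) :
    quadPhase ω (s + t) = quadPhase ω s * quadPhase ω t * (ω ^ t) ^ s := by
  have h : (s + t) * (s + t + 1) / 2 = s * (s + 1) / 2 + t * (t + 1) / 2 + t * s := by
    have h1 := Int.mul_succ_div_two_mul_two s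
    have h2 := Int.mul_succ_div_two_mul_two t
    have h3 := Int.mul_succ_div_two_mul_two (s + t)
    refine mul_right_cancel₀ (two_ne_zero (α := ℤ)) ?_
    linear_combination h3 - h1 - h2
  unfold quadPhase
  rw [h, zpow_add₀ hω, zpow_add₀ hω, zpow_add₀ (by norm_num), zpow_mul]
  ring

theorem norm_quadPhase {ω : ℂ} (hω : ‖ω‖ = 1) (s : ℤ) : ‖quadPhase ω s‖ = 1 := by
  simp [quadPhase, hω]

theorem quadPhase_neg_one_sub (ω : ℂ) (s : ℤ) : quadPhase ω (-1 - s) = -quadPhase ω s := by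
  have h : (-1 - s) * (-1 - s + 1) = s * (s + 1) := by ring
  have h2 : (-1 : ℂ) ^ (-1 - s) = -(-1) ^ s := by
    rw [zpow_sub₀ (by norm_num), zpow_neg_one, div_eq_mul_inv, ← inv_zpow]
    norm_num
  rw [quadPhase, h, h2, quadPhase, neg_mul]

/-- The sign has two sources. For odd `b` the exponent is a multiple of `b` and `(-1)^b = -1`; for
even `b` it is `b/2` modulo `b`, and `ω^{b/2} = -1`. -/
theorem quadPhase_order {b : ℕ} {ω : ℂ} (hb : 0 < b) (hω : IsPrimitiveRoot ω b) :
    quadPhase ω b = -1 := by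
  obtain ⟨c, hc | hc⟩ := Nat.even_or_odd' b
  · have h : ((b : ℤ) * (b + 1) / 2) = ((c * (2 * c + 1) : ℕ) : ℤ) := by
      refine mul_right_cancel₀ (two_ne_zero (α := ℤ)) ?_
      rw [Int.mul_succ_div_two_mul_two, hc]; push_cast; ring
    have h1 : ω ^ c = -1 := by
      have h2 : (ω ^ c) ^ 2 = 1 := by rw [← pow_mul, mul_comm, ← hc, hω.pow_eq_one]
      exact (sq_eq_sq_iff_eq_or_eq_neg.1 (h2.trans (one_pow 2).symm)).resolve_left
        (hω.pow_ne_one_of_pos_of_lt (by omega) (by omega))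
    have h3 : ω ^ (c * (2 * c + 1)) = -1 := by
      rw [show c * (2 * c + 1) = b * c + c by rw [hc]; ring, pow_add, pow_mul, hω.pow_eq_one, h1]
      simp
    rw [quadPhase, h, zpow_natCast, zpow_natCast, h3, hc, pow_mul]
    simp
  · have h : ((b : ℤ) * (b + 1) / 2) = ((b * (c + 1) : ℕ) : ℤ) := by
      refine mul_right_cancel₀ (two_ne_zero (α := ℤ)) ?_
      rw [Int.mul_succ_div_two_mul_two, hc]; push_cast; ring
    rw [quadPhase, h, zpow_natCast, zpow_natCast, pow_mul, hω.pow_eq_one, hc, pow_succ, pow_mul]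
    simp

theorem quadPhase_antiperiodic {b : ℕ} {ω : ℂ} (hb : 0 < b) (hω : IsPrimitiveRoot ω b) :
    Function.Antiperiodic (quadPhase ω) b := by
  intro s
  rw [quadPhase_add (hω.ne_zero hb.ne'), quadPhase_order hb hω, zpow_natCast, hω.pow_eq_one]
  simp

theorem quadPhase_add_mul {b : ℕ} {ω : ℂ} (hb : 0 < b) (hω : IsPrimitiveRoot ω b) (s n : ℤ) :
    quadPhase ω (s + n * b) = (-1) ^ n * quadPhase ω s := by
  have h := quadPhase_antiperiodic hb hω
  induction n with
  | zero => simp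
  | succ k ih =>
    rw [show s + ((k : ℤ) + 1) * b = s + k * b + b by ring, h, ih, zpow_add_one₀ (by norm_num)]
    ring
  | pred k ih =>
    have := h (s + (-(k : ℤ) - 1) * b)
    rw [show s + (-(k : ℤ) - 1) * b + b = s + -(k : ℤ) * b by ring, ih] at this
    rw [zpow_sub_one₀ (by norm_num)]
    linear_combination this - (-1) ^ (-(k : ℤ)) * quadPhase ω s * (by norm_num : ((-1 : ℂ)⁻¹ = -1))

/-- The Gauss sum `∑_{r < b} (-1)^r ω^{r(r+1)/2} e^{-πir/b}`. -/
noncomputable def gaussPhaseSum (ω : ℂ) (b : ℕ) : ℂ :=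
  ∑ r ∈ Finset.range b, quadPhase ω r * Complex.exp (-(Real.pi * Complex.I * r / b))

theorem Finset.sum_range_add_eq_of_periodic {M : Type*} [AddCommGroup M] {f : ℕ → M} {b : ℕ}
    (hf : Function.Periodic f b) (k : ℕ) :
    ∑ t ∈ Finset.range b, f (t + k) = ∑ t ∈ Finset.range b, f t := by
  induction k with
  | zero => rfl
  | succ k ih =>
    rw [← ih]
    have h1 := Finset.sum_range_succ (fun t => f (t + k)) b
    have h2 := Finset.sum_range_succ' (fun t => f (t + k)) b
    have h3 : f (b + k) = f (0 + k) := by rw [add_comm b k, hf, zero_add]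
    rw [h1, h3] at h2
    have := add_right_cancel h2
    rw [this]
    exact Finset.sum_congr rfl fun t _ => by congr 1; ring

/-- The summand `h` is `b`-periodic and satisfies `h(t+r) = h(t) h(r) ω^{tr}`. If its sum vanished,
so would every shifted sum, hence every discrete Fourier coefficient of `h`; but `h` has no zeros.
-/
theorem gaussPhaseSum_ne_zero {b : ℕ} {ω : ℂ} (hb : 0 < b) (hω : IsPrimitiveRoot ω b) :
    gaussPhaseSum ω b ≠ 0 := by
  have hω0 := hω.ne_zero hb.ne'
  have hb0 : (b : ℂ) ≠ 0 := by exact_mod_cast hb.ne'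
  set h : ℕ → ℂ := fun r => quadPhase ω r * Complex.exp (-(Real.pi * Complex.I * r / b)) with hh
  have hper : Function.Periodic h b := by
    intro r
    have h1 : quadPhase ω ((r + b : ℕ) : ℤ) = -quadPhase ω r := by
      push_cast; exact quadPhase_antiperiodic hb hω r
    have h2 : Complex.exp (-(Real.pi * Complex.I * ((r + b : ℕ) : ℂ) / b))
        = -Complex.exp (-(Real.pi * Complex.I * r / b)) := by
      rw [← Complex.exp_sub_pi_mul_I]
      congr 1; push_cast; field_simp; ring
    simp only [hh, h1, h2]; ring
  have hne : ∀ r, h r ≠ 0 := fun r => by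
    have : quadPhase ω r ≠ 0 := by
      rw [← norm_ne_zero_iff, norm_quadPhase (hω.norm'_eq_one hb.ne')]; norm_num
    exact mul_ne_zero this (Complex.exp_ne_zero _)
  have hadd : ∀ t r : ℕ, h (t + r) = h t * h r * (ω ^ t) ^ r := by
    intro t r
    have h1 : quadPhase ω ((t + r : ℕ) : ℤ) = quadPhase ω t * quadPhase ω r * (ω ^ t) ^ r := by
      push_cast
      rw [quadPhase_add hω0, zpow_natCast, zpow_natCast, ← pow_mul, ← pow_mul, mul_comm t r]
    have h2 : Complex.exp (-(Real.pi * Complex.I * ((t + r : ℕ) : ℂ) / b))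
        = Complex.exp (-(Real.pi * Complex.I * t / b))
          * Complex.exp (-(Real.pi * Complex.I * r / b)) := by
      rw [← Complex.exp_add]; congr 1; push_cast; ring
    simp only [hh, h1, h2]; ring
  intro h0
  have hz : ∀ r : ℕ, ∑ t ∈ Finset.range b, h t * (ω ^ t) ^ r = 0 := by
    intro r
    have h1 := Finset.sum_range_add_eq_of_periodic hper r
    rw [show ∑ t ∈ Finset.range b, h t = 0 from h0] at h1
    have h2 : ∑ t ∈ Finset.range b, h (t + r)
        = h r * ∑ t ∈ Finset.range b, h t * (ω ^ t) ^ r := by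
      rw [Finset.mul_sum]
      exact Finset.sum_congr rfl fun t _ => by rw [hadd]; ring
    rw [h2] at h1
    exact (mul_eq_zero.1 h1).resolve_left (hne r)
  -- Fourier inversion at `0`: orthogonality of the characters kills every `t ≠ 0`.
  have hsum : ∑ r ∈ Finset.range b, ∑ t ∈ Finset.range b, h t * (ω ^ t) ^ r = h 0 * b := by
    rw [Finset.sum_comm]
    rw [Finset.sum_eq_single_of_mem 0 (Finset.mem_range.2 hb)]
    · simp [mul_comm]
    · intro t ht ht0
      rw [← Finset.mul_sum]
      have h1 : ω ^ t ≠ 1 := hω.pow_ne_one_of_pos_of_lt ht0 (Finset.mem_range.1 ht)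
      rw [geom_sum_eq h1, ← pow_mul, mul_comm t b, pow_mul, hω.pow_eq_one]
      simp
  rw [Finset.sum_congr rfl fun r _ => hz r, Finset.sum_const_zero] at hsum
  exact mul_ne_zero (hne 0) hb0 hsum.symm

/-- Reflecting `r ↦ b-1-r` ties the frequency `-1` contribution to the same Gauss sum as the
frequency `+1`, which is why a single sine emerges. -/
theorem sum_quadPhase_mul_exp {b : ℕ} {ω : ℂ} (hb : 0 < b) (hω : IsPrimitiveRoot ω b) :
    ∑ r ∈ Finset.range b, quadPhase ω r * Complex.exp (Real.pi * Complex.I * r / b)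
      = -Complex.exp (-(Real.pi * Complex.I / b)) * gaussPhaseSum ω b := by
  have hb0 : (b : ℂ) ≠ 0 := by exact_mod_cast hb.ne'
  rw [← Finset.sum_range_reflect, gaussPhaseSum, Finset.mul_sum]
  refine Finset.sum_congr rfl fun r hr => ?_
  have hr' := Finset.mem_range.1 hr
  have e : b - 1 - r = b - (1 + r) := by omega
  have c1 : ((b - 1 - r : ℕ) : ℂ) = b - (1 + r) := by
    rw [e, Nat.cast_sub (by omega)]; push_cast; ring
  have c2 : ((b - 1 - r : ℕ) : ℤ) = (-1 - r) + b := by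
    rw [e, Nat.cast_sub (by omega)]; push_cast; ring
  rw [c1, c2, quadPhase_antiperiodic hb hω, quadPhase_neg_one_sub, neg_neg]
  have : Complex.exp (Real.pi * Complex.I * (b - (1 + r)) / b)
      = -(Complex.exp (-(Real.pi * Complex.I / b))
        * Complex.exp (-(Real.pi * Complex.I * r / b))) := by
    rw [← Complex.exp_add, ← Complex.exp_add_pi_mul_I]
    congr 1; field_simp; ring
  rw [this]; ring

/-! ### The scaled theta series and its splittings -/

/-- The terms of `H_N(ω e^{-τ/N}, v/N)`. -/
noncomputable def scaledTerm (ω : ℂ) (N : ℕ) (τ v : ℂ) (s : ℤ) : ℂ :=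
  quadPhase ω s * Complex.exp (-τ * (s * (s + 1)) / (2 * N) + s * v / N)

theorem windowTerm_eq_scaledTerm (ω : ℂ) (N : ℕ) (τ v : ℂ) (s : ℤ) :
    windowTerm (ω * Complex.exp (-τ / N)) (v / N) s = scaledTerm ω N τ v s := by
  have h : ((s * (s + 1) / 2 : ℤ) : ℂ) = s * (s + 1) / 2 := by
    have := congrArg (Int.cast : ℤ → ℂ) (Int.mul_succ_div_two_mul_two s)
    rw [Int.cast_mul, Int.cast_mul, Int.cast_add] at this
    rw [eq_div_iff two_ne_zero]
    simpa using this
  rw [windowTerm, scaledTerm, quadPhase, mul_zpow, ← Complex.exp_int_mul, h,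
    Complex.exp_add]
  ring_nf

theorem norm_mul_exp_lt_one {ω : ℂ} (hω : ‖ω‖ = 1) {N : ℕ} (hN : 0 < N) {τ : ℂ}
    (hτ : 0 < τ.re) : ‖ω * Complex.exp (-τ / N)‖ < 1 := by
  rw [norm_mul, hω, one_mul, Complex.norm_exp, Complex.div_natCast_re, Real.exp_lt_one_iff]
  rw [Complex.neg_re]
  exact div_neg_of_neg_of_pos (by linarith) (by exact_mod_cast hN)

theorem summable_scaledTerm_nat {ω : ℂ} (hω : ‖ω‖ = 1) {N : ℕ} (hN : 0 < N) {τ : ℂ}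
    (hτ : 0 < τ.re) (v : ℂ) (M : ℕ) :
    Summable fun k : ℕ => scaledTerm ω N τ v ((k : ℤ) - M) := by
  simp_rw [← windowTerm_eq_scaledTerm]
  exact summable_windowH (norm_mul_exp_lt_one hω hN hτ) M _

/-- The reflection preserves `s(s+1)` and flips the sign of the phase; it reduces summability over
negative indices to the one-sided case with `-v`. -/
theorem scaledTerm_neg_one_sub (ω : ℂ) (N : ℕ) (τ v : ℂ) (s : ℤ) :
    scaledTerm ω N τ v (-1 - s) = -Complex.exp (-v / N) * scaledTerm ω N τ (-v) s := by
  have h : -τ * (((-1 - s : ℤ) : ℂ) * (((-1 - s : ℤ) : ℂ) + 1)) / (2 * N)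
      + ((-1 - s : ℤ) : ℂ) * v / N
      = -v / N + (-τ * (s * (s + 1)) / (2 * N) + s * -v / N) := by
    push_cast
    ring
  rw [scaledTerm, scaledTerm, quadPhase_neg_one_sub, h, Complex.exp_add]
  ring

theorem summable_scaledTerm {ω : ℂ} (hω : ‖ω‖ = 1) {N : ℕ} (hN : 0 < N) {τ : ℂ}
    (hτ : 0 < τ.re) (v : ℂ) : Summable (scaledTerm ω N τ v) := by
  refine Summable.of_nat_of_neg_add_one ?_ ?_
  · simpa using summable_scaledTerm_nat hω hN hτ v 0
  · have := (summable_scaledTerm_nat hω hN hτ (-v) 0).mul_left (-Complex.exp (-v / N))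
    refine this.congr fun n => ?_
    rw [← scaledTerm_neg_one_sub]
    congr 1
    push_cast
    ring

theorem tsum_scaledTerm_eq_window_add_tail {ω : ℂ} (hω : ‖ω‖ = 1) {N : ℕ} (hN : 0 < N) {τ : ℂ}
    (hτ : 0 < τ.re) (v : ℂ) :
    ∑' s, scaledTerm ω N τ v s = windowH N (ω * Complex.exp (-τ / N)) (v / N)
      + ∑' m : ℕ, scaledTerm ω N τ v (-((N : ℤ) + 1 + m)) := by
  have hs := summable_scaledTerm hω hN hτ v
  rw [← (Equiv.subRight (N : ℤ)).tsum_eq, windowH]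
  simp_rw [windowTerm_eq_scaledTerm, Equiv.subRight_apply]
  have hs' : Summable fun s : ℤ => scaledTerm ω N τ v (s - N) :=
    (Equiv.subRight (N : ℤ)).summable_iff.2 hs
  rw [tsum_of_nat_of_neg_add_one (f := fun s : ℤ => scaledTerm ω N τ v (s - N))]
  · congr 1
    refine tsum_congr fun m => ?_
    congr 1; ring
  · exact hs'.comp_injective Nat.cast_injective
  · refine hs'.comp_injective fun x y h => ?_
    have : -((x : ℤ) + 1) = -((y : ℤ) + 1) := h
    omega

theorem tsum_scaledTerm_eq_sum_residues {ω : ℂ} (hω : ‖ω‖ = 1) {b : ℕ} (hb : 0 < b) {N : ℕ}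
    (hN : 0 < N) {τ : ℂ} (hτ : 0 < τ.re) (v : ℂ) :
    ∑' s, scaledTerm ω N τ v s
      = ∑ r ∈ Finset.range b, ∑' n : ℤ, scaledTerm ω N τ v (r + n * b) := by
  have hs := summable_scaledTerm hω hN hτ v
  have : NeZero b := ⟨hb.ne'⟩
  rw [← (Int.divModEquiv b).symm.tsum_eq]
  have hs' := (Int.divModEquiv b).symm.summable_iff.2 hs
  rw [← (Equiv.prodComm _ _).tsum_eq]
  have hs'' := (Equiv.prodComm _ _).summable_iff.2 hs'
  refine hs''.tsum_prod.trans ?_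
  rw [tsum_fintype, Finset.sum_range]
  refine Finset.sum_congr rfl fun r _ => tsum_congr fun n => ?_
  simp [add_comm]

/-! ### Poisson summation and the dominant frequencies -/

/-- The factor in front of the Poisson dual of the sum of `scaledTerm ω N τ v`. -/
noncomputable def poissonFactor (b N : ℕ) (τ v : ℂ) : ℂ :=
  1 / (τ * b ^ 2 / (2 * Real.pi * N)) ^ (1 / 2 : ℂ)
    * Complex.exp ((v - τ / 2) ^ 2 / (2 * N * τ))

/-- On one residue class the phase is a constant times `(-1)^n`, so the sum is a Jacobi theta
function at `(z, T)` and its functional equation is the Poisson formula. -/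
theorem tsum_scaledTerm_residue {b : ℕ} {ω : ℂ} (hb : 0 < b) (hω : IsPrimitiveRoot ω b) {N : ℕ}
    (hN : 0 < N) {τ : ℂ} (hτ : 0 < τ.re) (v : ℂ) (r : ℤ) :
    ∑' n : ℤ, scaledTerm ω N τ v (r + n * b)
      = poissonFactor b N τ v * (quadPhase ω r * ∑' n : ℤ,
        Complex.exp (-(Real.pi ^ 2 * N / (2 * τ * b ^ 2)) * (1 - 2 * n) ^ 2
          + Real.pi * Complex.I * (1 - 2 * n) * (v / τ - 1 / 2 - r) / b)) := by
  have hb0 : (b : ℂ) ≠ 0 := by exact_mod_cast hb.ne'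
  have hN0 : (N : ℂ) ≠ 0 := by exact_mod_cast hN.ne'
  have hτ0 : τ ≠ 0 := by rintro rfl; simp at hτ
  have hpi : (Real.pi : ℂ) ≠ 0 := by exact_mod_cast Real.pi_ne_zero
  have hI2 : Complex.I ^ 2 = -1 := Complex.I_sq
  -- The shift `1/2` encodes `(-1)^n` and moves the dual frequencies to the odd integers `1 - 2n`.
  set z : ℂ := 1 / 2 - Complex.I * b * (v - τ / 2 - τ * r) / (2 * Real.pi * N) with hz
  set T : ℂ := Complex.I * τ * b ^ 2 / (2 * Real.pi * N) with hT
  have hT0 : T ≠ 0 := by rw [hT]; simp [hτ0, hb0, hN0]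
  have e1 : ∀ n : ℤ, scaledTerm ω N τ v (r + n * b)
      = quadPhase ω r * Complex.exp (-τ * (r * (r + 1)) / (2 * N) + r * v / N)
        * jacobiTheta₂_term n z T := by
    intro n
    have hn : (-1 : ℂ) ^ n = Complex.exp (n * (Real.pi * Complex.I)) := by
      rw [Complex.exp_int_mul, Complex.exp_pi_mul_I]
    rw [scaledTerm, quadPhase_add_mul hb hω, hn, jacobiTheta₂_term, mul_comm (Complex.exp _),
      mul_assoc, mul_assoc, ← Complex.exp_add, ← Complex.exp_add]
    congr 2
    rw [hz, hT]
    push_cast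
    field_simp
    ring_nf
    rw [hI2]
    ring
  have e2 : ∀ n : ℤ, Complex.exp (-Real.pi * Complex.I * z ^ 2 / T)
      * jacobiTheta₂_term n (z / T) (-1 / T)
      = Complex.exp (-τ * (-(r * (r + 1))) / (2 * N) - r * v / N
        + (v - τ / 2) ^ 2 / (2 * N * τ))
      * Complex.exp (-(Real.pi ^ 2 * N / (2 * τ * b ^ 2)) * (1 - 2 * n) ^ 2
          + Real.pi * Complex.I * (1 - 2 * n) * (v / τ - 1 / 2 - r) / b) := by
    intro n
    rw [jacobiTheta₂_term, ← Complex.exp_add, ← Complex.exp_add]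
    congr 1
    have : -Real.pi * Complex.I * z ^ 2 / T
        + (2 * Real.pi * Complex.I * n * (z / T) + Real.pi * Complex.I * n ^ 2 * (-1 / T))
        = -(2 * Real.pi ^ 2 * N / (τ * b ^ 2)) * (z - n) ^ 2 := by
      rw [hT]; field_simp; ring
    rw [this, hz]
    field_simp
    ring_nf
    rw [hI2]
    ring
  have e3 : -Complex.I * T = τ * b ^ 2 / (2 * Real.pi * N) := by
    rw [hT]
    linear_combination (-(τ * b ^ 2 / (2 * Real.pi * N))) * hI2
  simp_rw [e1, tsum_mul_left]
  rw [← jacobiTheta₂, jacobiTheta₂_functional_equation, e3, jacobiTheta₂, mul_assoc (1 / _),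
    ← tsum_mul_left]
  simp_rw [e2, tsum_mul_left]
  rw [poissonFactor]
  have e4 : Complex.exp (-τ * (r * (r + 1)) / (2 * N) + r * v / N)
      * Complex.exp (-τ * (-(r * (r + 1))) / (2 * N) - r * v / N
        + (v - τ / 2) ^ 2 / (2 * N * τ)) = Complex.exp ((v - τ / 2) ^ 2 / (2 * N * τ)) := by
    rw [← Complex.exp_add]; congr 1; ring
  rw [← e4]
  ring

theorem summable_exp_neg_one_pow_natAbs :
    Summable fun k : ℤ => Real.exp (-1) ^ k.natAbs := by
  have h : Summable fun n : ℕ => Real.exp (-1) ^ n :=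
    summable_geometric_of_lt_one (Real.exp_nonneg _) (Real.exp_lt_one_iff.2 (by norm_num))
  refine Summable.of_nat_of_neg ?_ ?_ <;> simp [h]

/-- The Poisson dual sum, divided by its leading exponential, converges to the contribution of
the two lowest frequencies. -/
theorem tendsto_tsum_dual {α : Type*} {L : Filter α} {n : α → ℕ} {A : α → ℂ} {B : α → ℂ}
    {A₀ B₀ : ℂ} (hn : Tendsto n L atTop) (hA : Tendsto A L (𝓝 A₀)) (hA₀ : 0 < A₀.re)
    (hB : Tendsto B L (𝓝 B₀)) :
    Tendsto (fun x => ∑' k : ℤ, Complex.exp (-(A x * n x) * ((1 - 2 * k) ^ 2 - 1)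
      + (1 - 2 * k) * B x)) L (𝓝 (Complex.exp B₀ + Complex.exp (-B₀))) := by
  set g : ℤ → ℂ := fun k => if k = 0 then Complex.exp B₀ else if k = 1 then Complex.exp (-B₀)
    else 0 with hg
  have hgs : ∑' k, g k = Complex.exp B₀ + Complex.exp (-B₀) := by
    rw [tsum_eq_sum (s := {0, 1})]
    · simp [hg]
    · intro k hk
      simp only [Finset.mem_insert, Finset.mem_singleton, not_or] at hk
      simp [hg, hk.1, hk.2]
  have hn' : Tendsto (fun x => (n x : ℝ)) L atTop := tendsto_natCast_atTop_atTop.comp hn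
  have hAre : Tendsto (fun x => (A x).re) L (𝓝 A₀.re) :=
    (Complex.continuous_re.tendsto _).comp hA
  have hAn : Tendsto (fun x => (A x).re * n x) L atTop := hAre.pos_mul_atTop hA₀ hn'
  have hre : ∀ x (k : ℤ), (-(A x * n x) * ((1 - 2 * (k : ℂ)) ^ 2 - 1)).re
      = -((A x).re * n x * ((1 - 2 * (k : ℝ)) ^ 2 - 1)) := by
    intro x k
    have : (-(A x * n x) * ((1 - 2 * (k : ℂ)) ^ 2 - 1))
        = ((-(n x * ((1 - 2 * (k : ℝ)) ^ 2 - 1)) : ℝ) : ℂ) * A x := by push_cast; ring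
    rw [this, Complex.re_ofReal_mul]; ring
  rw [← hgs]
  -- For `m = |1 - 2k|`, completing the square gives `-(m²-1) + m(‖B₀‖+1) ≤ 1 + (‖B₀‖+2)²/4 - m`,
  -- and `|k| ≤ m`; hence this majorant once `Re A · n ≥ 1`.
  refine tendsto_tsum_of_dominated_convergence
    (bound := fun k => Real.exp (1 + (‖B₀‖ + 2) ^ 2 / 4) * Real.exp (-1) ^ k.natAbs)
    (summable_exp_neg_one_pow_natAbs.mul_left _) (fun k => ?_) ?_
  · by_cases h0 : k = 0
    · simpa [hg, h0, Function.comp_def] using (Complex.continuous_exp.tendsto _).comp hB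
    by_cases h1 : k = 1
    · simp only [hg, h1]
      norm_num
      exact (Complex.continuous_exp.tendsto _).comp hB.neg
    simp only [hg, h0, h1, if_false]
    simp_rw [Complex.exp_add]
    have hk : (0 : ℝ) < (1 - 2 * (k : ℝ)) ^ 2 - 1 := by
      have h2 : 0 < k * (k - 1) := by
        rcases lt_or_gt_of_ne h0 with h | h
        · exact mul_pos_of_neg_of_neg h (by omega)
        · exact mul_pos h (by omega)
      have h3 : (0 : ℝ) < k * (k - 1) := by exact_mod_cast h2
      nlinarith
    have hz : Tendsto (fun x => Complex.exp (-(A x * n x) * ((1 - 2 * (k : ℂ)) ^ 2 - 1))) L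
        (𝓝 0) := by
      rw [tendsto_zero_iff_norm_tendsto_zero]
      simp_rw [Complex.norm_exp, hre]
      exact Real.tendsto_exp_neg_atTop_nhds_zero.comp (hAn.atTop_mul_const hk)
    simpa using hz.mul ((Complex.continuous_exp.tendsto _).comp (hB.const_mul (1 - 2 * (k : ℂ))))
  · have hBn : ∀ᶠ x in L, ‖B x‖ < ‖B₀‖ + 1 := hB.norm.eventually_lt_const (by linarith)
    filter_upwards [hBn, hAn.eventually_ge_atTop 1] with x hx1 hx2 k
    rw [Complex.norm_exp, Complex.add_re, hre, ← Real.exp_nat_mul, ← Real.exp_add,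
      Real.exp_le_exp]
    set m : ℝ := |1 - 2 * (k : ℝ)| with hm
    have hm2 : (1 - 2 * (k : ℝ)) ^ 2 = m ^ 2 := (sq_abs _).symm
    have hmk : (k.natAbs : ℝ) ≤ m := by
      have h2 : k.natAbs ≤ (1 - 2 * k).natAbs := by omega
      have h3 : ((1 - 2 * k).natAbs : ℝ) = m := by
        rw [hm, Nat.cast_natAbs]; push_cast; rfl
      rw [← h3]; exact_mod_cast h2
    have hm1 : 1 ≤ m ^ 2 := by
      have h2 : (1 : ℤ) ≤ (1 - 2 * k) ^ 2 := by
        have : (0 : ℤ) < (1 - 2 * k) ^ 2 := by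
          have : (1 - 2 * k) ≠ 0 := by omega
          positivity
        omega
      rw [← hm2]; exact_mod_cast h2
    have hBb : ((1 - 2 * (k : ℂ)) * B x).re ≤ m * (‖B₀‖ + 1) := by
      refine (Complex.re_le_norm _).trans ?_
      rw [norm_mul]
      have : ‖(1 - 2 * (k : ℂ))‖ = m := by
        rw [show (1 - 2 * (k : ℂ)) = ((1 - 2 * (k : ℝ) : ℝ) : ℂ) by push_cast; rfl,
          Complex.norm_real, Real.norm_eq_abs]
      rw [this]
      gcongr
    rw [hm2]
    nlinarith [sq_nonneg (m - (‖B₀‖ + 2) / 2), mul_nonneg (sub_nonneg.2 hx2) (sub_nonneg.2 hm1)]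

/-! ### The tail below `-N` -/

/-- The limit of the sum of the terms of index below `-N`, up to an elementary factor. -/
noncomputable def tailLimit (ω : ℂ) (b a : ℕ) : ℂ :=
  ∑' m : ℕ, quadPhase ω (-((a : ℤ) + 1 + m)) * Complex.exp (-(Real.pi / b) * (m + 1))

theorem summable_tailLimit {ω : ℂ} (hω : ‖ω‖ = 1) {b : ℕ} (hb : 0 < b) (a : ℕ) :
    Summable fun m : ℕ => quadPhase ω (-((a : ℤ) + 1 + m))
      * Complex.exp (-(Real.pi / b) * (m + 1)) := by
  have hc : 0 < Real.pi / b := div_pos Real.pi_pos (by exact_mod_cast hb)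
  have h : Summable fun m : ℕ => Real.exp (-(Real.pi / b)) * Real.exp (-(Real.pi / b)) ^ m :=
    (summable_geometric_of_lt_one (Real.exp_nonneg _) (Real.exp_lt_one_iff.2 (by linarith))).mul_left _
  refine Summable.of_norm (h.congr fun m => ?_)
  rw [norm_mul, norm_quadPhase hω, one_mul, ← Real.exp_nat_mul, ← Real.exp_add, Complex.norm_exp]
  congr 1
  rw [show (-(Real.pi / b) * (m + 1) : ℂ) = ((-(Real.pi / b) * (m + 1) : ℝ) : ℂ) by push_cast; rfl,
    Complex.ofReal_re]
  ring

/-- Splitting off the first term relates the limits for `a = 0` and `a = 1`: they differ by the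
factor `e^{-π/b}` and a nonzero summand, so they cannot both vanish. -/
theorem exists_tailLimit_ne_zero {ω : ℂ} (hω : ‖ω‖ = 1) {b : ℕ} (hb : 0 < b) :
    ∃ a, tailLimit ω b a ≠ 0 := by
  by_contra! h
  have h0 := h 0
  have h1 := h 1
  rw [tailLimit, (summable_tailLimit hω hb 0).tsum_eq_zero_add] at h0
  have h2 : ∑' m : ℕ, quadPhase ω (-(((0 : ℕ) : ℤ) + 1 + ((m + 1 : ℕ) : ℤ)))
      * Complex.exp (-(Real.pi / b) * (((m + 1 : ℕ) : ℂ) + 1))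
      = Complex.exp (-(Real.pi / b)) * tailLimit ω b 1 := by
    rw [tailLimit, ← tsum_mul_left]
    refine tsum_congr fun m => ?_
    rw [mul_left_comm, ← Complex.exp_add]
    congr 2
    · push_cast; ring
    · push_cast; ring
  rw [h2, h1, mul_zero, add_zero] at h0
  have h3 := norm_quadPhase hω (-(((0 : ℕ) : ℤ) + 1 + ((0 : ℕ) : ℤ)))
  rw [(mul_eq_zero.1 h0).resolve_right (Complex.exp_ne_zero _)] at h3
  simp at h3

/-- Expanding the exponent around the edge of the window isolates the exponential size; the
remaining factor is nearly geometric in `m`. -/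
theorem scaledTerm_tail {ω : ℂ} {N : ℕ} (hN : 0 < N) (τ v : ℂ) (m : ℕ) :
    scaledTerm ω N τ v (-((N : ℤ) + 1 + m)) = Complex.exp (-τ * (N - 1) / 2 - v)
      * (quadPhase ω (-((N : ℤ) + 1 + m))
        * Complex.exp (-(τ + τ * m / (2 * N) + v / N) * (m + 1))) := by
  have hN0 : (N : ℂ) ≠ 0 := by exact_mod_cast hN.ne'
  rw [scaledTerm]
  conv_rhs => rw [mul_left_comm, ← Complex.exp_add]
  congr 2
  push_cast
  field_simp
  ring

/-- The modulus is `2b` because a shift by `b` changes the sign of the phase. -/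
theorem quadPhase_neg_of_modEq {ω : ℂ} {b : ℕ} (hb : 0 < b) (hω : IsPrimitiveRoot ω b) {N a : ℕ}
    (h : N ≡ a [MOD 2 * b]) (m : ℕ) :
    quadPhase ω (-((N : ℤ) + 1 + m)) = quadPhase ω (-((a : ℤ) + 1 + m)) := by
  obtain ⟨k, hk⟩ := (Nat.modEq_iff_dvd.1 h)
  have : -((N : ℤ) + 1 + m) = -((a : ℤ) + 1 + m) + (2 * k) * b := by
    push_cast at hk
    linear_combination hk
  rw [this, quadPhase_add_mul hb hω, zpow_mul]
  simp

theorem tendsto_tsum_tail {α : Type*} {L : Filter α} {n : α → ℕ} {t v : α → ℂ} {v₀ : ℂ}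
    {ω : ℂ} {b : ℕ} (hb : 0 < b) (hω : IsPrimitiveRoot ω b) {a : ℕ}
    (hn : Tendsto n L atTop) (ha : ∀ᶠ x in L, n x ≡ a [MOD 2 * b])
    (ht : Tendsto t L (𝓝 (Real.pi / b))) (hv : Tendsto v L (𝓝 v₀)) :
    Tendsto (fun x => ∑' m : ℕ, quadPhase ω (-((n x : ℤ) + 1 + m))
        * Complex.exp (-(t x + t x * m / (2 * n x) + v x / n x) * (m + 1))) L
      (𝓝 (tailLimit ω b a)) := by
  have hc : 0 < Real.pi / b := div_pos Real.pi_pos (by exact_mod_cast hb)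
  have hninv : Tendsto (fun x => ((n x : ℂ))⁻¹) L (𝓝 0) :=
    (tendsto_inv_atTop_nhds_zero_nat (𝕜 := ℂ)).comp hn
  have hvn : Tendsto (fun x => v x / n x) L (𝓝 0) := by
    simpa [div_eq_mul_inv] using hv.mul hninv
  -- Eventually `Re (t + v/n) > π/(4b)` and `Re t > 0`; the term quadratic in `m` then only helps,
  -- leaving a geometric majorant.
  refine tendsto_tsum_of_dominated_convergence
    (bound := fun m : ℕ => Real.exp (-(Real.pi / b / 4)) ^ m)
    (summable_geometric_of_lt_one (Real.exp_nonneg _) (Real.exp_lt_one_iff.2 (by linarith)))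
    (fun m => ?_) ?_
  · refine Tendsto.mul ?_ ((Complex.continuous_exp.tendsto _).comp ?_)
    · refine tendsto_const_nhds.congr' ?_
      filter_upwards [ha] with x hx
      rw [quadPhase_neg_of_modEq hb hω hx]
    · have h1 : Tendsto (fun x => t x * m / (2 * n x)) L (𝓝 0) := by
        have := ((ht.mul_const (m : ℂ)).mul_const (1 / 2 : ℂ)).mul hninv
        rw [mul_zero] at this
        refine this.congr fun x => ?_
        ring
      simpa using ((((ht.add h1).add hvn)).neg).mul_const ((m : ℂ) + 1)
  · have hre : Tendsto (fun x => (t x + v x / n x).re) L (𝓝 (Real.pi / b)) := by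
      have h := (Complex.continuous_re.tendsto _).comp (ht.add hvn)
      have e : ((Real.pi : ℂ) / b + 0).re = Real.pi / b := by
        rw [add_zero, Complex.div_natCast_re, Complex.ofReal_re]
      rw [e] at h
      exact h
    have htre : Tendsto (fun x => (t x).re) L (𝓝 (Real.pi / b)) := by
      have h := (Complex.continuous_re.tendsto _).comp ht
      have e : ((Real.pi : ℂ) / b).re = Real.pi / b := by
        rw [Complex.div_natCast_re, Complex.ofReal_re]
      rw [e] at h
      exact h
    filter_upwards [hre.eventually_const_lt (show Real.pi / b / 4 < Real.pi / b by linarith),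
      htre.eventually_const_lt hc] with x h1 h2 m
    rw [norm_mul, norm_quadPhase (hω.norm'_eq_one hb.ne'), one_mul, Complex.norm_exp,
      ← Real.exp_nat_mul, Real.exp_le_exp]
    have e : (-(t x + t x * m / (2 * n x) + v x / n x) * (m + 1)).re
        = -((t x + v x / n x).re + (t x).re * (m / (2 * n x))) * (m + 1) := by
      have : (-(t x + t x * m / (2 * n x) + v x / n x) * ((m : ℂ) + 1))
          = ((-((m : ℝ) + 1) : ℝ) : ℂ) * (t x + v x / n x)
            + ((-((m : ℝ) / (2 * n x)) * (m + 1) : ℝ) : ℂ) * t x := by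
        push_cast; ring
      rw [this, Complex.add_re, Complex.re_ofReal_mul, Complex.re_ofReal_mul]
      ring
    rw [e]
    have h3 : 0 ≤ (t x).re * (m / (2 * n x)) := by positivity
    have h4 : (0 : ℝ) ≤ m := by positivity
    nlinarith

/-! ### Balancing the two pieces -/

/-- The scale `τ = π/b + (s - (log N)/2)/N` on which double zeros appear. -/
noncomputable def tauScale (b N : ℕ) (s : ℂ) : ℂ :=
  Real.pi / b + (s - (Real.log N / 2 : ℝ)) / N

/-- The inverse of the size of `∑ s, scaledTerm ω N τ v s`. -/
noncomputable def normalizer (b N : ℕ) (τ v : ℂ) : ℂ :=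
  (τ * b ^ 2 / (2 * Real.pi * N)) ^ (1 / 2 : ℂ)
    * Complex.exp (Real.pi ^ 2 * N / (2 * τ * b ^ 2) - (v - τ / 2) ^ 2 / (2 * N * τ))

theorem normalizer_base_ne_zero {b N : ℕ} (hb : 0 < b) (hN : 0 < N) {τ : ℂ} (hτ : τ ≠ 0) :
    τ * b ^ 2 / (2 * Real.pi * N) ≠ 0 := by
  have hb0 : (b : ℂ) ≠ 0 := by exact_mod_cast hb.ne'
  have hN0 : (N : ℂ) ≠ 0 := by exact_mod_cast hN.ne'
  have hpi : (Real.pi : ℂ) ≠ 0 := by exact_mod_cast Real.pi_ne_zero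
  simp [hτ, hb0, hN0]

theorem normalizer_ne_zero {b N : ℕ} (hb : 0 < b) (hN : 0 < N) {τ : ℂ} (hτ : τ ≠ 0) (v : ℂ) :
    normalizer b N τ v ≠ 0 := by
  refine mul_ne_zero ?_ (Complex.exp_ne_zero _)
  rw [Complex.cpow_def_of_ne_zero (normalizer_base_ne_zero hb hN hτ)]
  exact Complex.exp_ne_zero _

/-- Dividing out the lowest dual exponential replaces `(1-2k)²` by `(1-2k)² - 1`, which vanishes
exactly for `k = 0, 1`. -/
theorem tsum_scaledTerm_mul_normalizer {ω : ℂ} {b : ℕ} (hb : 0 < b) (hω : IsPrimitiveRoot ω b)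
    {N : ℕ} (hN : 0 < N) {τ : ℂ} (hτ : 0 < τ.re) (v : ℂ) :
    (∑' s, scaledTerm ω N τ v s) * normalizer b N τ v
      = ∑ r ∈ Finset.range b, quadPhase ω r * ∑' k : ℤ,
        Complex.exp (-(Real.pi ^ 2 / (2 * τ * b ^ 2) * N) * ((1 - 2 * k) ^ 2 - 1)
          + (1 - 2 * k) * (Real.pi * Complex.I * (v / τ - 1 / 2 - r) / b)) := by
  have hτ0 : τ ≠ 0 := by rintro rfl; simp at hτ
  have h0 := normalizer_base_ne_zero hb hN hτ0
  have hc : (τ * b ^ 2 / (2 * Real.pi * N)) ^ (1 / 2 : ℂ) ≠ 0 := by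
    rw [Complex.cpow_def_of_ne_zero h0]
    exact Complex.exp_ne_zero _
  have hP : poissonFactor b N τ v * normalizer b N τ v
      = Complex.exp (Real.pi ^ 2 / (2 * τ * b ^ 2) * N) := by
    rw [poissonFactor, normalizer, mul_mul_mul_comm, one_div_mul_cancel hc, one_mul,
      ← Complex.exp_add]
    congr 1; ring
  rw [tsum_scaledTerm_eq_sum_residues (hω.norm'_eq_one hb.ne') hb hN hτ, Finset.sum_mul]
  refine Finset.sum_congr rfl fun r _ => ?_
  have := tsum_scaledTerm_residue hb hω hN hτ v r
  rw [this, mul_right_comm, hP, mul_left_comm, ← tsum_mul_left]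
  congr 1
  refine tsum_congr fun k => ?_
  rw [← Complex.exp_add]
  congr 1
  push_cast
  ring

theorem sum_quadPhase_mul_two_exp {ω : ℂ} {b : ℕ} (hb : 0 < b) (hω : IsPrimitiveRoot ω b)
    (v : ℂ) :
    ∑ r ∈ Finset.range b, quadPhase ω r
      * (Complex.exp (Real.pi * Complex.I * (v / (Real.pi / b) - 1 / 2 - r) / b)
        + Complex.exp (-(Real.pi * Complex.I * (v / (Real.pi / b) - 1 / 2 - r) / b)))
      = 2 * Complex.I * gaussPhaseSum ω b * Complex.exp (-(Real.pi * Complex.I / (2 * b)))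
        * Complex.sin v := by
  have hb0 : (b : ℂ) ≠ 0 := by exact_mod_cast hb.ne'
  have hpi : (Real.pi : ℂ) ≠ 0 := by exact_mod_cast Real.pi_ne_zero
  have e1 : ∀ r : ℕ, Complex.exp (Real.pi * Complex.I * (v / (Real.pi / b) - 1 / 2 - r) / b)
      = Complex.exp (v * Complex.I) * Complex.exp (-(Real.pi * Complex.I / (2 * b)))
        * Complex.exp (-(Real.pi * Complex.I * r / b)) := by
    intro r
    rw [← Complex.exp_add, ← Complex.exp_add]
    congr 1; field_simp; ring
  have e2 : ∀ r : ℕ, Complex.exp (-(Real.pi * Complex.I * (v / (Real.pi / b) - 1 / 2 - r) / b))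
      = Complex.exp (-v * Complex.I) * Complex.exp (Real.pi * Complex.I / (2 * b))
        * Complex.exp (Real.pi * Complex.I * r / b) := by
    intro r
    rw [← Complex.exp_add, ← Complex.exp_add]
    congr 1; field_simp; ring
  have e3 : Complex.exp (Real.pi * Complex.I / (2 * b)) * Complex.exp (-(Real.pi * Complex.I / b))
      = Complex.exp (-(Real.pi * Complex.I / (2 * b))) := by
    rw [← Complex.exp_add]
    congr 1; field_simp; ring
  simp_rw [e1, e2, mul_add, Finset.sum_add_distrib]
  have s1 : ∑ r ∈ Finset.range b, quadPhase ω r * (Complex.exp (v * Complex.I)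
        * Complex.exp (-(Real.pi * Complex.I / (2 * b)))
        * Complex.exp (-(Real.pi * Complex.I * r / b)))
      = Complex.exp (v * Complex.I) * Complex.exp (-(Real.pi * Complex.I / (2 * b)))
        * gaussPhaseSum ω b := by
    rw [gaussPhaseSum, Finset.mul_sum]
    exact Finset.sum_congr rfl fun r _ => by ring
  have s2 : ∑ r ∈ Finset.range b, quadPhase ω r * (Complex.exp (-v * Complex.I)
        * Complex.exp (Real.pi * Complex.I / (2 * b))
        * Complex.exp (Real.pi * Complex.I * r / b))
      = Complex.exp (-v * Complex.I) * Complex.exp (Real.pi * Complex.I / (2 * b))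
        * (-Complex.exp (-(Real.pi * Complex.I / b)) * gaussPhaseSum ω b) := by
    rw [← sum_quadPhase_mul_exp hb hω, Finset.mul_sum]
    exact Finset.sum_congr rfl fun r _ => by ring
  rw [s1, s2, Complex.sin]
  linear_combination (-(Complex.exp (-v * Complex.I) * gaussPhaseSum ω b)) * e3
    - gaussPhaseSum ω b * Complex.exp (-(Real.pi * Complex.I / (2 * b)))
      * (Complex.exp (-v * Complex.I) - Complex.exp (v * Complex.I)) * Complex.I_sq

/-- This is where the scale comes from. With `δ = τ - π/b`, the exponents `π²N/(2τb²)` and `-τN/2`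
add up to `-Nδ + Nδ²/(2τ)`. Here `-Nδ = -s + (log N)/2`, and the logarithm cancels the `N^{-1/2}` of
the square root; the quadratic remainder is of order `(log N)²/N`. -/
theorem exp_mul_normalizer {b N : ℕ} (hb : 0 < b) (hN : 0 < N) (s v : ℂ)
    (hτ : tauScale b N s ≠ 0) :
    Complex.exp (-tauScale b N s * (N - 1) / 2 - v) * normalizer b N (tauScale b N s) v
      = (tauScale b N s * (b ^ 2 / (2 * Real.pi))) ^ (1 / 2 : ℂ)
        * Complex.exp (tauScale b N s / 2 - s - v
          + (s - (Real.log N / 2 : ℝ)) ^ 2 / N * (2 * tauScale b N s)⁻¹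
          - (v - tauScale b N s / 2) ^ 2 / (2 * tauScale b N s) * (N : ℂ)⁻¹) := by
  have hb0 : (b : ℂ) ≠ 0 := by exact_mod_cast hb.ne'
  have hN0 : (N : ℂ) ≠ 0 := by exact_mod_cast hN.ne'
  have hpi : (Real.pi : ℂ) ≠ 0 := by exact_mod_cast Real.pi_ne_zero
  have hdef : tauScale b N s = Real.pi / b + (s - (Real.log N / 2 : ℝ)) / N := rfl
  set τ := tauScale b N s with hτdef
  have hbase : τ * (b ^ 2 / (2 * Real.pi)) ≠ 0 := by simp [hτ, hb0]
  have h1 : τ * b ^ 2 / (2 * Real.pi * N) = ((N : ℝ)⁻¹ : ℝ) * (τ * (b ^ 2 / (2 * Real.pi))) := by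
    push_cast; field_simp
  have hlog : Complex.log (τ * b ^ 2 / (2 * Real.pi * N))
      = -(Real.log N : ℝ) + Complex.log (τ * (b ^ 2 / (2 * Real.pi))) := by
    rw [h1, Complex.log_ofReal_mul (by positivity) hbase, Real.log_inv]
    push_cast; rfl
  rw [normalizer, Complex.cpow_def_of_ne_zero (normalizer_base_ne_zero hb hN hτ),
    Complex.cpow_def_of_ne_zero hbase, hlog, ← Complex.exp_add, ← Complex.exp_add,
    ← Complex.exp_add]
  congr 1
  have hd : s - (Real.log N / 2 : ℝ) = N * (τ - Real.pi / b) := by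
    rw [hdef]; field_simp; ring
  have hl : ((Real.log N : ℝ) : ℂ) = 2 * (s - N * (τ - Real.pi / b)) := by
    rw [← hd]; push_cast; ring
  rw [hd, hl]
  field_simp
  ring

theorem tendsto_log_natCast_div {α : Type*} {L : Filter α} {n : α → ℕ}
    (hn : Tendsto n L atTop) (j : ℕ) :
    Tendsto (fun x => (((Real.log (n x)) ^ j / n x : ℝ) : ℂ)) L (𝓝 0) := by
  have h : Tendsto (fun y : ℝ => Real.log y ^ j / y) atTop (𝓝 0) :=
    (Real.isLittleO_pow_log_id_atTop (n := j)).tendsto_div_nhds_zero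
  have h2 := h.comp (tendsto_natCast_atTop_atTop.comp hn)
  exact_mod_cast (Complex.continuous_ofReal.tendsto 0).comp h2

theorem tendsto_tauScale {α : Type*} {L : Filter α} {n : α → ℕ} {s : α → ℂ} {s₀ : ℂ} (b : ℕ)
    (hn : Tendsto n L atTop) (hs : Tendsto s L (𝓝 s₀)) :
    Tendsto (fun x => tauScale b (n x) (s x)) L (𝓝 (Real.pi / b)) := by
  have hninv : Tendsto (fun x => ((n x : ℂ))⁻¹) L (𝓝 0) :=
    (tendsto_inv_atTop_nhds_zero_nat (𝕜 := ℂ)).comp hn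
  have h := ((hs.mul hninv).sub ((tendsto_log_natCast_div hn 1).mul_const (1 / 2 : ℂ))).const_add
    ((Real.pi : ℂ) / b)
  simp only [mul_zero, zero_mul, sub_zero, add_zero] at h
  refine h.congr fun x => ?_
  rw [tauScale]; push_cast; ring

theorem tendsto_sub_log_sq_div {α : Type*} {L : Filter α} {n : α → ℕ} {s : α → ℂ} {s₀ : ℂ}
    (hn : Tendsto n L atTop) (hs : Tendsto s L (𝓝 s₀)) :
    Tendsto (fun x => (s x - (Real.log (n x) / 2 : ℝ)) ^ 2 / n x) L (𝓝 0) := by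
  have hninv : Tendsto (fun x => ((n x : ℂ))⁻¹) L (𝓝 0) :=
    (tendsto_inv_atTop_nhds_zero_nat (𝕜 := ℂ)).comp hn
  have h := (((hs.pow 2).mul hninv).sub (hs.mul (tendsto_log_natCast_div hn 1))).add
    ((tendsto_log_natCast_div hn 2).mul_const (1 / 4 : ℂ))
  simp only [mul_zero, zero_mul, sub_zero, add_zero] at h
  refine h.congr fun x => ?_
  push_cast; ring

theorem pi_div_natCast_mem_slitPlane {b : ℕ} (hb : 0 < b) :
    (Real.pi : ℂ) / b ∈ Complex.slitPlane := by
  left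
  rw [Complex.div_natCast_re, Complex.ofReal_re]
  exact div_pos Real.pi_pos (by exact_mod_cast hb)

/-- The limit of `exp_mul_normalizer`, without the dependence on `s` and `v`. -/
noncomputable def tailFactor (b : ℕ) : ℂ :=
  ((Real.pi / b : ℂ) * (b ^ 2 / (2 * Real.pi))) ^ (1 / 2 : ℂ) * Complex.exp ((Real.pi / b : ℂ) / 2)

theorem tailFactor_ne_zero {b : ℕ} (hb : 0 < b) : tailFactor b ≠ 0 := by
  have hb0 : (b : ℂ) ≠ 0 := by exact_mod_cast hb.ne'
  have hpi : (Real.pi : ℂ) ≠ 0 := by exact_mod_cast Real.pi_ne_zero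
  refine mul_ne_zero ?_ (Complex.exp_ne_zero _)
  rw [Complex.cpow_def_of_ne_zero (by simp [hb0])]
  exact Complex.exp_ne_zero _

theorem mul_sq_div_two_pi_mem_slitPlane {b : ℕ} (hb : 0 < b) {τ : ℂ} (hτ : 0 < τ.re) :
    τ * (b ^ 2 / (2 * Real.pi)) ∈ Complex.slitPlane := by
  left
  have : τ * ((b : ℂ) ^ 2 / (2 * Real.pi)) = (((b : ℝ) ^ 2 / (2 * Real.pi) : ℝ) : ℂ) * τ := by
    push_cast; ring
  rw [this, Complex.re_ofReal_mul]
  have : (0 : ℝ) < b := by exact_mod_cast hb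
  have := Real.pi_pos
  positivity

theorem tendsto_exp_mul_normalizer {α : Type*} {L : Filter α} {n : α → ℕ} {s v : α → ℂ}
    {s₀ v₀ : ℂ} {b : ℕ} (hb : 0 < b) (hn : Tendsto n L atTop) (hs : Tendsto s L (𝓝 s₀))
    (hv : Tendsto v L (𝓝 v₀)) :
    Tendsto (fun x => Complex.exp (-tauScale b (n x) (s x) * (n x - 1) / 2 - v x)
      * normalizer b (n x) (tauScale b (n x) (s x)) (v x)) L
      (𝓝 (tailFactor b * Complex.exp (-s₀ - v₀))) := by
  have ht := tendsto_tauScale b hn hs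
  have hsp := pi_div_natCast_mem_slitPlane hb
  have hre : 0 < ((Real.pi : ℂ) / b).re := by
    rw [Complex.div_natCast_re, Complex.ofReal_re]
    exact div_pos Real.pi_pos (by exact_mod_cast hb)
  have ht0 : (Real.pi : ℂ) / b ≠ 0 := Complex.slitPlane_ne_zero hsp
  have hninv : Tendsto (fun x => ((n x : ℂ))⁻¹) L (𝓝 0) :=
    (tendsto_inv_atTop_nhds_zero_nat (𝕜 := ℂ)).comp hn
  have h2t : (2 * ((Real.pi : ℂ) / b)) ≠ 0 := mul_ne_zero two_ne_zero ht0
  have h1 := (ht.mul_const ((b : ℂ) ^ 2 / (2 * Real.pi))).cpow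
    (tendsto_const_nhds (x := (1 / 2 : ℂ))) (mul_sq_div_two_pi_mem_slitPlane hb hre)
  have h2 := ((((ht.div_const 2).sub hs).sub hv).add ((tendsto_sub_log_sq_div hn hs).mul
    ((ht.const_mul 2).inv₀ h2t))).sub
    ((((hv.sub (ht.div_const 2)).pow 2).div (ht.const_mul 2) h2t).mul hninv)
  have h3 := h1.mul ((Complex.continuous_exp.tendsto _).comp h2)
  have e : tailFactor b * Complex.exp (-s₀ - v₀)
      = ((Real.pi / b : ℂ) * (b ^ 2 / (2 * Real.pi))) ^ (1 / 2 : ℂ)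
        * Complex.exp ((Real.pi / b : ℂ) / 2 - s₀ - v₀ + 0 * (2 * ((Real.pi : ℂ) / b))⁻¹
          - (v₀ - (Real.pi / b : ℂ) / 2) ^ 2 / (2 * (Real.pi / b : ℂ)) * 0) := by
    rw [tailFactor, mul_assoc, ← Complex.exp_add]
    congr 2; ring
  rw [e]
  refine h3.congr' ?_
  filter_upwards [hn.eventually_gt_atTop 0, ht.eventually_ne ht0] with x hx hx2
  rw [exp_mul_normalizer hb hx _ _ hx2]
  rfl

/-- The window is the full series minus the tail, each with its own limit. The parameters vary along
an arbitrary filter so that the statement also yields uniformity in `(s, v)`. -/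
theorem tendsto_windowH_mul_normalizer {α : Type*} {L : Filter α} {n : α → ℕ} {s v : α → ℂ}
    {s₀ v₀ : ℂ} {ω : ℂ} {b : ℕ} (hb : 0 < b) (hω : IsPrimitiveRoot ω b) {a : ℕ}
    (hn : Tendsto n L atTop) (ha : ∀ᶠ x in L, n x ≡ a [MOD 2 * b])
    (hs : Tendsto s L (𝓝 s₀)) (hv : Tendsto v L (𝓝 v₀)) :
    Tendsto (fun x => windowH (n x) (ω * Complex.exp (-tauScale b (n x) (s x) / n x)) (v x / n x)
        * normalizer b (n x) (tauScale b (n x) (s x)) (v x)) L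
      (𝓝 (2 * Complex.I * gaussPhaseSum ω b * Complex.exp (-(Real.pi * Complex.I / (2 * b)))
        * Complex.sin v₀ - tailLimit ω b a * tailFactor b * Complex.exp (-s₀ - v₀))) := by
  have ht := tendsto_tauScale b hn hs
  have hre : 0 < ((Real.pi : ℂ) / b).re := by
    rw [Complex.div_natCast_re, Complex.ofReal_re]
    exact div_pos Real.pi_pos (by exact_mod_cast hb)
  have hb0 : (b : ℂ) ≠ 0 := by exact_mod_cast hb.ne'
  have hpi : (Real.pi : ℂ) ≠ 0 := by exact_mod_cast Real.pi_ne_zero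
  have ht0 : (Real.pi : ℂ) / b ≠ 0 := div_ne_zero hpi hb0
  have hA : Tendsto (fun x => (Real.pi : ℂ) ^ 2 / (2 * tauScale b (n x) (s x) * b ^ 2)) L
      (𝓝 ((Real.pi / (2 * b) : ℝ) : ℂ)) := by
    have h := (tendsto_const_nhds (x := (Real.pi : ℂ) ^ 2)).div
      ((ht.const_mul 2).mul_const ((b : ℂ) ^ 2))
      (mul_ne_zero (mul_ne_zero two_ne_zero ht0) (pow_ne_zero 2 hb0))
    have e : ((Real.pi / (2 * b) : ℝ) : ℂ)
        = (Real.pi : ℂ) ^ 2 / (2 * ((Real.pi : ℂ) / b) * (b : ℂ) ^ 2) := by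
      push_cast; field_simp
    rw [e]
    exact h
  have hA0 : 0 < ((Real.pi / (2 * b) : ℝ) : ℂ).re := by
    rw [Complex.ofReal_re]
    exact div_pos Real.pi_pos (by positivity)
  have hfull := tendsto_finsetSum (Finset.range b) fun r _ =>
    (tendsto_tsum_dual hn hA hA0 (((((hv.div ht ht0).sub_const (1 / 2 : ℂ)).sub_const
      (r : ℂ)).const_mul ((Real.pi : ℂ) * Complex.I)).div_const (b : ℂ))).const_mul
      (quadPhase ω r)
  rw [sum_quadPhase_mul_two_exp hb hω] at hfull
  have htail := (tendsto_tsum_tail hb hω hn ha ht hv).mul (tendsto_exp_mul_normalizer hb hn hs hv)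
  rw [mul_assoc (tailLimit ω b a)]
  refine (hfull.sub htail).congr' ?_
  have htre : ∀ᶠ x in L, 0 < (tauScale b (n x) (s x)).re :=
    ((Complex.continuous_re.tendsto _).comp ht).eventually_const_lt hre
  filter_upwards [hn.eventually_gt_atTop 0, htre] with x hN hx
  have h1 := tsum_scaledTerm_mul_normalizer hb hω hN hx (v x)
  rw [tsum_scaledTerm_eq_window_add_tail (hω.norm'_eq_one hb.ne') hN hx] at h1
  simp_rw [scaledTerm_tail hN, tsum_mul_left] at h1
  simp only [Pi.div_apply]
  rw [← h1]
  ring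

/-! ### Holomorphy, and the passage from `H_N` to `Θ` -/

theorem norm_scaledTerm {ω : ℂ} (hω : ‖ω‖ = 1) (N : ℕ) (τ v : ℂ) (s : ℤ) :
    ‖scaledTerm ω N τ v s‖
      = Real.exp (-(τ.re * ((s * (s + 1)) / (2 * N))) + s / N * v.re) := by
  have e : -τ * (s * (s + 1)) / (2 * N) + s * v / N
      = ((-((s * (s + 1)) / (2 * N)) : ℝ) : ℂ) * τ + ((s / N : ℝ) : ℂ) * v := by
    push_cast; ring
  rw [scaledTerm, norm_mul, norm_quadPhase hω, one_mul, Complex.norm_exp, e, Complex.add_re,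
    Complex.re_ofReal_mul, Complex.re_ofReal_mul]
  congr 1; ring

theorem differentiable_windowH_scaled {ω : ℂ} (hω : ‖ω‖ = 1) {N : ℕ} (hN : 0 < N) {τ : ℂ}
    (hτ : 0 < τ.re) :
    Differentiable ℂ fun v => windowH N (ω * Complex.exp (-τ / N)) (v / N) := by
  simp_rw [windowH, windowTerm_eq_scaledTerm]
  intro v
  have hv : v ∈ Metric.ball (0 : ℂ) (‖v‖ + 1) := by simp
  set M := ‖v‖ + 1 with hM
  -- Terms with `s ≥ 0` are largest at `v = M`; for `-N ≤ s < 0` the ratio `s/N ≥ -1` costs at most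
  -- `e^{2M}`.
  refine (Complex.differentiableOn_tsum_of_summable_norm
    (u := fun k : ℕ => Real.exp (2 * M) * ‖scaledTerm ω N τ M ((k : ℤ) - N)‖)
    ((summable_scaledTerm_nat hω hN hτ M N).norm.mul_left _)
    (fun k => ?_) Metric.isOpen_ball (fun k w hw => ?_)).differentiableAt
    (Metric.isOpen_ball.mem_nhds hv)
  · unfold scaledTerm
    fun_prop
  · rw [norm_scaledTerm hω, norm_scaledTerm hω, ← Real.exp_add, Real.exp_le_exp, Complex.ofReal_re]
    have h1 : |w.re| ≤ M := (Complex.abs_re_le_norm w).trans ((mem_ball_zero_iff.1 hw).le)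
    have h2 : (-1 : ℝ) ≤ (((k : ℤ) - (N : ℤ) : ℤ) : ℝ) / N := by
      rw [le_div_iff₀ (by exact_mod_cast hN)]
      push_cast
      have : (0 : ℝ) ≤ k := by positivity
      linarith
    have h3 := abs_le.1 h1
    nlinarith

theorem differentiableAt_windowH_scaled {ω : ℂ} (hω : ‖ω‖ = 1) {N : ℕ} (hN : 0 < N) {τ : ℂ}
    (hτ : 0 < τ.re) (v : ℂ) :
    DifferentiableAt ℂ (fun τ => windowH N (ω * Complex.exp (-τ / N)) (v / N)) τ := by
  simp_rw [windowH, windowTerm_eq_scaledTerm]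
  have hU : IsOpen {z : ℂ | τ.re / 2 < z.re} := isOpen_lt continuous_const Complex.continuous_re
  have hmem : τ ∈ {z : ℂ | τ.re / 2 < z.re} := by
    simp only [Set.mem_ofPred_eq]; linarith
  have hτ2 : 0 < ((τ.re / 2 : ℝ) : ℂ).re := by rw [Complex.ofReal_re]; positivity
  -- Since `s(s+1) ≥ 0` for integers, term norms decrease in `Re τ`, so the edge of the half-plane
  -- gives the majorant.
  refine (Complex.differentiableOn_tsum_of_summable_norm
    (u := fun k : ℕ => ‖scaledTerm ω N (τ.re / 2 : ℝ) v ((k : ℤ) - N)‖)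
    (summable_scaledTerm_nat hω hN hτ2 v N).norm
    (fun k => ?_) hU (fun k w hw => ?_)).differentiableAt (hU.mem_nhds hmem)
  · unfold scaledTerm
    fun_prop
  · rw [norm_scaledTerm hω, norm_scaledTerm hω, Real.exp_le_exp, Complex.ofReal_re]
    have hw' : τ.re / 2 ≤ w.re := le_of_lt hw
    have h0 : ∀ s : ℤ, (0 : ℝ) ≤ (s * (s + 1)) / (2 * N) := by
      intro s
      have h1 : 0 ≤ s * (s + 1) := by
        rcases le_or_gt 0 s with h | h
        · positivity
        · exact mul_nonneg_of_nonpos_of_nonpos h.le (by omega)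
      have h2 : (0 : ℝ) ≤ s * (s + 1) := by exact_mod_cast h1
      positivity
    have := mul_le_mul_of_nonneg_right hw' (h0 ((k : ℤ) - N))
    linarith

theorem differentiable_partialTheta {q : ℂ} (hq : ‖q‖ < 1) :
    Differentiable ℂ (partialTheta q) := by
  intro x
  have hx : x ∈ Metric.ball (0 : ℂ) (‖x‖ + 1) := by simp
  refine (Complex.differentiableOn_tsum_of_summable_norm
    (u := fun j : ℕ => ‖q ^ (j * (j + 1) / 2) * ((‖x‖ + 1 : ℝ) : ℂ) ^ j‖)
    (summable_partialTheta hq _).norm (fun j => by fun_prop) Metric.isOpen_ball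
    (fun j w hw => ?_)).differentiableAt (Metric.isOpen_ball.mem_nhds hx)
  rw [norm_mul, norm_mul, norm_pow w, norm_pow (_ : ℂ) j, Complex.norm_real,
    Real.norm_of_nonneg (by positivity)]
  have : ‖w‖ ≤ ‖x‖ + 1 := (mem_ball_zero_iff.1 hw).le
  gcongr

/-- Recentring the summation index at `N` completes the square in the exponent of `q`; the leftover
factor does not depend on the index. -/
theorem partialTheta_eq_mul_windowH {q : ℂ} (hq : q ≠ 0) (N : ℕ) (u : ℂ) :
    partialTheta q (-(q ^ N)⁻¹ * Complex.exp u)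
      = (-1) ^ N * (q ^ ((-N : ℤ) * (-N + 1) / 2))⁻¹ * Complex.exp (N * u) * windowH N q u := by
  rw [partialTheta, windowH, ← tsum_mul_left]
  refine tsum_congr fun j => ?_
  have h : ((j : ℤ) - N) * ((j : ℤ) - N + 1) / 2
      = ((j * (j + 1) / 2 : ℕ) : ℤ) + ((-N : ℤ) * (-N + 1) / 2) - N * j := by
    have h1 := Int.mul_succ_div_two_mul_two ((j : ℤ) - N)
    have h2 := Int.mul_succ_div_two_mul_two (-N)
    have h3 := Int.mul_succ_div_two_mul_two j
    push_cast
    refine mul_right_cancel₀ (two_ne_zero (α := ℤ)) ?_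
    linear_combination h1 - h2 - h3
  have h1 : (-1 : ℂ) ^ ((j : ℤ) - N) = (-1) ^ j * (-1) ^ N := by
    rw [zpow_sub₀ (by norm_num), zpow_natCast, zpow_natCast, div_eq_mul_inv, ← inv_pow]
    norm_num
  have h2 : ((-1 : ℂ) ^ N) * (-1) ^ N = 1 := by rw [← mul_pow]; norm_num
  have h3 : Complex.exp ((((j : ℤ) - N : ℤ) : ℂ) * u) * Complex.exp (N * u)
      = Complex.exp u ^ j := by
    rw [← Complex.exp_add, ← Complex.exp_nat_mul]
    congr 1; push_cast; ring
  have h4 : q ^ ((-N : ℤ) * (-N + 1) / 2) ≠ 0 := zpow_ne_zero _ hq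
  have h5 : (-(q ^ N)⁻¹ * Complex.exp u) ^ j
      = (-1) ^ j * (q ^ ((N : ℤ) * j))⁻¹ * Complex.exp u ^ j := by
    rw [mul_pow, neg_pow, inv_pow, ← pow_mul]
    norm_cast
  rw [windowTerm, h5, ← h3, h1, h, zpow_sub₀ hq, zpow_add₀ hq, zpow_natCast]
  field_simp
  linear_combination (-1 : ℂ) * h2

/-- The chain rule for `x = -q^{-N} e^u` suffices because `dx/du = x ≠ 0`. -/
theorem isMultipleZero_of_windowH {q : ℂ} (hq : q ≠ 0) (hq1 : ‖q‖ < 1) {N : ℕ} {u : ℂ}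
    (h0 : windowH N q u = 0) (h1 : HasDerivAt (fun w => windowH N q w) 0 u) :
    IsMultipleZero q (-(q ^ N)⁻¹ * Complex.exp u) := by
  refine ⟨by rw [partialTheta_eq_mul_windowH hq, h0, mul_zero], ?_⟩
  have hd := (differentiable_partialTheta hq1 (-(q ^ N)⁻¹ * Complex.exp u)).hasDerivAt
  have hc := hd.comp u ((Complex.hasDerivAt_exp u).const_mul (-(q ^ N)⁻¹))
  have hE : DifferentiableAt ℂ (fun w => (-1) ^ N * (q ^ ((-N : ℤ) * (-N + 1) / 2))⁻¹
      * Complex.exp (N * w)) u := by fun_prop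
  have hr := hE.hasDerivAt.mul h1
  have e : partialTheta q ∘ (fun w => -(q ^ N)⁻¹ * Complex.exp w)
      = fun w => (-1) ^ N * (q ^ ((-N : ℤ) * (-N + 1) / 2))⁻¹ * Complex.exp (N * w)
        * windowH N q w := funext fun w => partialTheta_eq_mul_windowH hq N w
  rw [e] at hc
  have h2 := hc.unique hr
  rw [h0, mul_zero, mul_zero, add_zero] at h2
  have h3 : -(q ^ N)⁻¹ * Complex.exp u ≠ 0 :=
    mul_ne_zero (neg_ne_zero.2 (inv_ne_zero (pow_ne_zero N hq))) (Complex.exp_ne_zero _)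
  rw [(mul_eq_zero.1 h2).resolve_right h3] at hd
  exact hd

theorem differentiable_normalizer (b N : ℕ) (τ : ℂ) : Differentiable ℂ (normalizer b N τ) := by
  unfold normalizer
  fun_prop

theorem differentiableAt_normalizer {b N : ℕ} (hb : 0 < b) (hN : 0 < N) {τ : ℂ} (hτ : 0 < τ.re)
    (v : ℂ) : DifferentiableAt ℂ (fun τ => normalizer b N τ v) τ := by
  have hτ0 : τ ≠ 0 := by rintro rfl; simp at hτ
  have hb0 : (b : ℂ) ≠ 0 := by exact_mod_cast hb.ne'
  have hN0 : (N : ℂ) ≠ 0 := by exact_mod_cast hN.ne'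
  have hs : τ * b ^ 2 / (2 * Real.pi * N) ∈ Complex.slitPlane := by
    have h : τ * b ^ 2 / (2 * Real.pi * N)
        = ((N : ℝ)⁻¹ : ℝ) * (τ * (b ^ 2 / (2 * Real.pi))) := by push_cast; ring
    left
    rw [h, Complex.re_ofReal_mul]
    have h2 : τ * ((b : ℂ) ^ 2 / (2 * Real.pi)) = (((b : ℝ) ^ 2 / (2 * Real.pi) : ℝ) : ℂ) * τ := by
      push_cast; ring
    rw [h2, Complex.re_ofReal_mul]
    have := Real.pi_pos
    positivity
  unfold normalizer
  refine DifferentiableAt.mul (DifferentiableAt.cpow (by fun_prop) (by fun_prop) hs) ?_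
  refine DifferentiableAt.cexp (DifferentiableAt.sub ?_ ?_)
  · exact DifferentiableAt.div (by fun_prop) (by fun_prop) (by simp [hτ0, hb0])
  · exact DifferentiableAt.div (by fun_prop) (by fun_prop) (by simp [hτ0, hN0])

/-! ### The limiting model and its nondegenerate double zero -/

/-- The function `κ sin v - μ e^{-s-v}`, with a double zero in `v` at `3π/4` for a suitable `s`. -/
noncomputable def doubleZeroModel (κ μ s v : ℂ) : ℂ :=
  κ * Complex.sin v - μ * Complex.exp (-s - v)

theorem hasDerivAt_doubleZeroModel (κ μ s v : ℂ) :
    HasDerivAt (doubleZeroModel κ μ s) (κ * Complex.cos v + μ * Complex.exp (-s - v)) v := by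
  have h := ((Complex.hasDerivAt_sin v).const_mul κ).sub
    ((((hasDerivAt_id v).const_sub (-s)).cexp).const_mul μ)
  have e : κ * Complex.cos v - μ * (Complex.exp (-s - v) * -1)
      = κ * Complex.cos v + μ * Complex.exp (-s - v) := by ring
  rw [← e]
  exact h

/-- The linear automorphism `(h, k) ↦ (e h, -e h - 2 e k)`. -/
noncomputable def doubleZeroJacobian (e : ℂ) (he : e ≠ 0) : (ℂ × ℂ) ≃L[ℂ] (ℂ × ℂ) :=
  LinearEquiv.toContinuousLinearEquiv
    { toFun := fun p => (e * p.1, -(e * p.1) - 2 * e * p.2)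
      invFun := fun p => (p.1 / e, -(p.1 + p.2) / (2 * e))
      map_add' := fun p r => by ext <;> simp <;> ring
      map_smul' := fun c p => by ext <;> simp <;> ring
      left_inv := fun p => by
        refine Prod.ext ?_ ?_
        · simp [he]
        · simp only; field_simp; ring
      right_inv := fun p => by
        refine Prod.ext ?_ ?_
        · simp only; field_simp
        · simp only; field_simp; ring }

/-- The three equations express the double zero through one number `e`; the Jacobian is then lower
triangular with determinant `-2e²`. -/
theorem hasStrictFDerivAt_doubleZeroModel {κ μ s v e : ℂ} (he : e ≠ 0)
    (h1 : κ * Complex.sin v = e) (h2 : κ * Complex.cos v = -e)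
    (h3 : μ * Complex.exp (-s - v) = e) :
    HasStrictFDerivAt (fun p : ℂ × ℂ => (doubleZeroModel κ μ p.1 p.2,
      deriv (doubleZeroModel κ μ p.1) p.2))
      (doubleZeroJacobian e he : (ℂ × ℂ) →L[ℂ] (ℂ × ℂ)) (s, v) := by
  simp_rw [(hasDerivAt_doubleZeroModel κ μ _ _).deriv, doubleZeroModel]
  have hsin := ((Complex.hasStrictDerivAt_sin v).comp_hasStrictFDerivAt (s, v)
    (hasStrictFDerivAt_snd (𝕜 := ℂ) (p := ((s, v) : ℂ × ℂ)))).const_mul κ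
  have hcos := ((Complex.hasStrictDerivAt_cos v).comp_hasStrictFDerivAt (s, v)
    (hasStrictFDerivAt_snd (𝕜 := ℂ) (p := ((s, v) : ℂ × ℂ)))).const_mul κ
  have hexp := (((hasStrictFDerivAt_fst (𝕜 := ℂ) (p := ((s, v) : ℂ × ℂ))).neg.sub
    (hasStrictFDerivAt_snd (𝕜 := ℂ) (p := ((s, v) : ℂ × ℂ)))).cexp).const_mul μ
  have h := (hsin.sub hexp).prodMk (hcos.add hexp)
  refine h.congr_fderiv ?_
  refine ContinuousLinearMap.ext fun p => Prod.ext ?_ ?_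
  · change κ * (Complex.cos v * p.2) - μ * (Complex.exp (-s - v) * (-p.1 - p.2)) = e * p.1
    linear_combination p.2 * h2 + (p.1 + p.2) * h3
  · change κ * (-Complex.sin v * p.2) + μ * (Complex.exp (-s - v) * (-p.1 - p.2))
      = -(e * p.1) - 2 * e * p.2
    linear_combination -p.2 * h1 - (p.1 + p.2) * h3

theorem isBigO_tauScale_sub {l : Filter ℕ} (hl : l ≤ atTop) (b : ℕ) {s : ℕ → ℂ} {s₀ : ℂ}
    (hs : Tendsto s l (𝓝 s₀)) :
    (fun N : ℕ => tauScale b N (s N) - (Real.pi : ℂ) / b) =O[l]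
      fun N : ℕ => Real.log N / N := by
  have hlog : (fun _ : ℕ => (1 : ℝ)) =O[l] fun N : ℕ => Real.log N :=
    ((Real.isLittleO_const_log_atTop (c := 1)).comp_tendsto
      (tendsto_natCast_atTop_atTop.mono_left hl)).isBigO
  have h1 : s =O[l] fun N : ℕ => Real.log N := (hs.isBigO_one ℝ).trans hlog
  have h2 : (fun N : ℕ => ((Real.log N / 2 : ℝ) : ℂ)) =O[l] fun N : ℕ => Real.log N := by
    refine IsBigO.of_bound 1 (Eventually.of_forall fun N => ?_)
    rw [Complex.norm_real, norm_div, Real.norm_ofNat]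
    linarith [norm_nonneg (Real.log N)]
  have h3 : (fun N : ℕ => ((N : ℂ))⁻¹) =O[l] fun N : ℕ => ((N : ℝ))⁻¹ :=
    IsBigO.of_norm_le fun N => by simp
  refine ((h1.sub h2).mul h3).congr (fun N => ?_) (fun N => ?_)
  · rw [tauScale]; ring
  · rw [div_eq_mul_inv]

/-- Joint convergence in index and point is local uniformity when the limit is continuous, and
compactness makes it uniform. This is what lets limits along arbitrary filters replace explicit
error bounds. -/
theorem tendstoUniformlyOn_of_forall_tendsto {ι X Y : Type*} [TopologicalSpace X]
    [UniformSpace Y] {l : Filter ι} {F : ι → X → Y} {f : X → Y} {K : Set X} (hK : IsCompact K)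
    (hf : Continuous f)
    (h : ∀ x ∈ K, Tendsto (fun y : ι × X => F y.1 y.2) (l ×ˢ 𝓝 x) (𝓝 (f x))) :
    TendstoUniformlyOn F f l K := by
  rw [← tendstoLocallyUniformlyOn_iff_tendstoUniformlyOn_of_compact hK,
    tendstoLocallyUniformlyOn_iff_forall_tendsto]
  intro x hx
  have h1 : Tendsto (fun y : ι × X => f y.2) (l ×ˢ 𝓝 x) (𝓝 (f x)) :=
    (hf.tendsto x).comp tendsto_snd
  exact ((h1.prodMk_nhds (h x hx)).mono_right (nhds_le_uniformity _)).mono_left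
    (prod_mono_right _ nhdsWithin_le_nhds)

theorem sin_three_pi_div_four_eq_neg_cos :
    Complex.sin ((3 * Real.pi / 4 : ℝ) : ℂ) = -Complex.cos ((3 * Real.pi / 4 : ℝ) : ℂ) ∧
      Complex.sin ((3 * Real.pi / 4 : ℝ) : ℂ) ≠ 0 := by
  have e : 3 * Real.pi / 4 = Real.pi - Real.pi / 4 := by ring
  rw [← Complex.ofReal_sin, ← Complex.ofReal_cos, e, Real.sin_pi_sub, Real.cos_pi_sub,
    Real.sin_pi_div_four, Real.cos_pi_div_four]
  constructor
  · push_cast; ring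
  · exact_mod_cast (by positivity : (0 : ℝ) < √2 / 2).ne'

/-! ### Double zeros of `H_N` and the conclusion -/

/-- The normalised function `H_N` in the variables `s` and `v`. -/
noncomputable def normalizedWindow (ω : ℂ) (b N : ℕ) (s v : ℂ) : ℂ :=
  windowH N (ω * Complex.exp (-tauScale b N s / N)) (v / N) * normalizer b N (tauScale b N s) v

theorem exists_double_zero_normalizedWindow {b : ℕ} (hb : 0 < b) {ω : ℂ}
    (hω : IsPrimitiveRoot ω b) :
    ∃ (a : ℕ) (s₀ : ℂ) (p : ℕ → ℂ × ℂ),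
      Tendsto p (atTop ⊓ 𝓟 {N : ℕ | N ≡ a [MOD 2 * b]})
        (𝓝 (s₀, ((3 * Real.pi / 4 : ℝ) : ℂ))) ∧
      ∀ᶠ N in atTop ⊓ 𝓟 {N : ℕ | N ≡ a [MOD 2 * b]},
        normalizedWindow ω b N (p N).1 (p N).2 = 0 ∧
          deriv (normalizedWindow ω b N (p N).1) (p N).2 = 0 := by
  have hω1 := hω.norm'_eq_one hb.ne'
  obtain ⟨a, ha⟩ := exists_tailLimit_ne_zero hω1 hb
  set l : Filter ℕ := atTop ⊓ 𝓟 {N : ℕ | N ≡ a [MOD 2 * b]} with hl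
  have hla : l ≤ atTop := inf_le_left
  set κ : ℂ := 2 * Complex.I * gaussPhaseSum ω b * Complex.exp (-(Real.pi * Complex.I / (2 * b)))
    with hκ
  set μ : ℂ := tailLimit ω b a * tailFactor b with hμ
  have hκ0 : κ ≠ 0 := mul_ne_zero (mul_ne_zero (mul_ne_zero two_ne_zero Complex.I_ne_zero)
    (gaussPhaseSum_ne_zero hb hω)) (Complex.exp_ne_zero _)
  have hμ0 : μ ≠ 0 := mul_ne_zero ha (tailFactor_ne_zero hb)
  set v₀ : ℂ := ((3 * Real.pi / 4 : ℝ) : ℂ) with hv₀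
  obtain ⟨hsc, hs0⟩ := sin_three_pi_div_four_eq_neg_cos
  have he : κ * Complex.sin v₀ ≠ 0 := mul_ne_zero hκ0 hs0
  -- Chosen to solve `μ e^{-s₀-v₀} = κ sin v₀`; the derivative vanishes as well since `sin v₀ = -cos
  -- v₀`.
  set s₀ : ℂ := -(Complex.log (κ * Complex.sin v₀ / μ) + v₀) with hs₀
  have hexp : μ * Complex.exp (-s₀ - v₀) = κ * Complex.sin v₀ := by
    rw [hs₀, show -(-(Complex.log (κ * Complex.sin v₀ / μ) + v₀)) - v₀
      = Complex.log (κ * Complex.sin v₀ / μ) by ring, Complex.exp_log (div_ne_zero he hμ0),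
      mul_div_cancel₀ _ hμ0]
  have hre : 0 < ((Real.pi : ℂ) / b).re := by
    rw [Complex.div_natCast_re, Complex.ofReal_re]
    exact div_pos Real.pi_pos (by exact_mod_cast hb)
  have htu : ∀ᶠ N in l, ∀ s ∈ Metric.ball s₀ 1, 0 < (tauScale b N s).re := by
    have h : TendstoUniformlyOn (fun N s => tauScale b N s) (fun _ => (Real.pi : ℂ) / b) l
        (Metric.closedBall s₀ 1) :=
      tendstoUniformlyOn_of_forall_tendsto (isCompact_closedBall _ _) continuous_const
        fun s _ => tendsto_tauScale b (tendsto_fst.mono_right hla) tendsto_snd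
    filter_upwards [Metric.tendstoUniformlyOn_iff.1 h _ hre] with N hN s hs
    have h1 := hN s (Metric.ball_subset_closedBall hs)
    rw [dist_eq_norm] at h1
    have h2 := (Complex.re_le_norm _).trans_lt h1
    rw [Complex.sub_re] at h2
    linarith
  have hpos : ∀ᶠ N in l, 0 < N := hla (eventually_gt_atTop 0)
  have hts : ∀ N, Differentiable ℂ (tauScale b N) := fun N => by
    unfold tauScale; fun_prop
  have hF1 : ∀ᶠ N in l, ∀ v ∈ Metric.ball v₀ 1,
      DifferentiableOn ℂ (fun s => normalizedWindow ω b N s v) (Metric.ball s₀ 1) := by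
    filter_upwards [htu, hpos] with N hN hN0 v _ s hs
    exact (((differentiableAt_windowH_scaled hω1 hN0 (hN s hs) v).comp s (hts N s)).mul
      ((differentiableAt_normalizer hb hN0 (hN s hs) v).comp s (hts N s))).differentiableWithinAt
  have hF2 : ∀ᶠ N in l, ∀ s ∈ Metric.ball s₀ 1,
      DifferentiableOn ℂ (normalizedWindow ω b N s) (Metric.ball v₀ 1) := by
    filter_upwards [htu, hpos] with N hN hN0 s hs
    exact ((differentiable_windowH_scaled hω1 hN0 (hN s hs)).mul
      (differentiable_normalizer b N _)).differentiableOn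
  have hu : TendstoUniformlyOn (fun N (x : ℂ × ℂ) => normalizedWindow ω b N x.1 x.2)
      (fun x => doubleZeroModel κ μ x.1 x.2) l (Metric.ball s₀ 1 ×ˢ Metric.ball v₀ 1) := by
    refine TendstoUniformlyOn.mono (s := Metric.closedBall s₀ 1 ×ˢ Metric.closedBall v₀ 1) ?_
      (Set.prod_mono Metric.ball_subset_closedBall Metric.ball_subset_closedBall)
    refine tendstoUniformlyOn_of_forall_tendsto
      ((isCompact_closedBall _ _).prod (isCompact_closedBall _ _)) ?_ fun x _ => ?_
    · unfold doubleZeroModel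
      fun_prop
    · have h2 : Tendsto (fun y : ℕ × (ℂ × ℂ) => y.2) (l ×ˢ 𝓝 x) (𝓝 x) := tendsto_snd
      exact tendsto_windowH_mul_normalizer hb hω (tendsto_fst.mono_right hla)
        (tendsto_fst.eventually (mem_inf_of_right (mem_principal_self _)))
        ((continuous_fst.tendsto x).comp h2) ((continuous_snd.tendsto x).comp h2)
  have hΦ : ∀ v, Differentiable ℂ (fun s => doubleZeroModel κ μ s v) := fun v => by
    unfold doubleZeroModel
    fun_prop
  have hcos : κ * Complex.cos v₀ = -(κ * Complex.sin v₀) := by rw [hsc]; ring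
  obtain ⟨p, hp, hpz⟩ := exists_tendsto_double_zero one_pos hF1 hF2 hΦ
    (fun s v => (hasDerivAt_doubleZeroModel κ μ s v).differentiableAt) hu
    (hasStrictFDerivAt_doubleZeroModel he rfl hcos hexp)
    (by rw [doubleZeroModel, hexp, sub_self])
    (by rw [(hasDerivAt_doubleZeroModel κ μ _ _).deriv, hexp, hcos, neg_add_cancel])
  exact ⟨a, s₀, p, hp, hpz⟩

/-- A nonvanishing holomorphic factor does not affect a double zero, and neither does the rescaling
`v = N u`. -/
theorem hasDerivAt_windowH_of_deriv_normalizedWindow {b : ℕ} (hb : 0 < b) {ω : ℂ}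
    (hω : ‖ω‖ = 1) {N : ℕ} (hN : 0 < N) {s v : ℂ} (hτ : 0 < (tauScale b N s).re)
    (h0 : normalizedWindow ω b N s v = 0) (h1 : deriv (normalizedWindow ω b N s) v = 0) :
    windowH N (ω * Complex.exp (-tauScale b N s / N)) (v / N) = 0 ∧
      HasDerivAt (fun w => windowH N (ω * Complex.exp (-tauScale b N s / N)) w) 0 (v / N) := by
  have hN0 : (N : ℂ) ≠ 0 := by exact_mod_cast hN.ne'
  have hτ0 : tauScale b N s ≠ 0 := fun h => by simp [h] at hτ
  have hW := normalizer_ne_zero hb hN hτ0 v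
  have hH := (mul_eq_zero.1 h0).resolve_right hW
  refine ⟨hH, ?_⟩
  have hd := differentiable_windowH_scaled hω hN hτ
  have h2 := (hd v).hasDerivAt.mul (differentiable_normalizer b N (tauScale b N s) v).hasDerivAt
  have h3 := h1.symm.trans h2.deriv
  rw [hH, zero_mul, add_zero] at h3
  have h4 : HasDerivAt (fun v => windowH N (ω * Complex.exp (-tauScale b N s / N)) (v / N)) 0
      ((N : ℂ) * (v / N)) := by
    rw [mul_div_cancel₀ _ hN0]
    have := (hd v).hasDerivAt
    rwa [(mul_eq_zero.1 h3.symm).resolve_right hW] at this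
  have h5 := h4.comp (v / N) ((hasDerivAt_id (v / (N : ℂ))).const_mul (N : ℂ))
  rw [zero_mul] at h5
  refine h5.congr_of_eventuallyEq (Eventually.of_forall fun w => ?_)
  simp [mul_div_cancel_left₀ _ hN0]

theorem mainTheorem1 (b : ℕ) (hb : 0 < b) (ω : ℂ) (hω : IsPrimitiveRoot ω b) :
    ∃ (d a : ℕ) (τ v q u x : ℕ → ℂ) (l : Filter ℕ),
      0 < d ∧
      l = atTop ⊓ 𝓟 {N : ℕ | N ≡ a [MOD d]} ∧
      (fun N : ℕ => τ N - (Real.pi : ℂ) / (b : ℂ)) =O[l]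
        (fun N : ℕ => Real.log (N : ℝ) / (N : ℝ)) ∧
      Tendsto v l (𝓝 ((3 * Real.pi / 4 : ℝ) : ℂ)) ∧
      (∀ N : ℕ, q N = ω * Complex.exp (-(τ N) / (N : ℂ))) ∧
      (∀ N : ℕ, u N = v N / (N : ℂ)) ∧
      (∀ N : ℕ, x N = -((q N) ^ N)⁻¹ * Complex.exp (u N)) ∧
      Tendsto q l (𝓝 ω) ∧
      ∀ᶠ N in l,
        windowH N (q N) (u N) = 0 ∧
        HasDerivAt (fun w : ℂ => windowH N (q N) w) 0 (u N) ∧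
        ‖q N‖ < 1 ∧
        IsMultipleZero (q N) (x N) ∧
        q N ∈ thetaSpec := by
  obtain ⟨a, s₀, p, hp, hz⟩ := exists_double_zero_normalizedWindow hb hω
  have hω1 := hω.norm'_eq_one hb.ne'
  have hω0 := hω.ne_zero hb.ne'
  have hs : Tendsto (fun N => (p N).1) (atTop ⊓ 𝓟 {N : ℕ | N ≡ a [MOD 2 * b]}) (𝓝 s₀) :=
    (continuous_fst.tendsto _).comp hp
  have ht := tendsto_tauScale b (tendsto_id.mono_left inf_le_left) hs
  refine ⟨2 * b, a, fun N => tauScale b N (p N).1, fun N => (p N).2,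
    fun N => ω * Complex.exp (-tauScale b N (p N).1 / N), fun N => (p N).2 / N, _, _,
    by positivity, rfl, isBigO_tauScale_sub inf_le_left b hs, (continuous_snd.tendsto _).comp hp,
    fun _ => rfl, fun _ => rfl, fun _ => rfl, ?_, ?_⟩
  · have hninv : Tendsto (fun N : ℕ => ((N : ℂ))⁻¹) (atTop ⊓ 𝓟 {N : ℕ | N ≡ a [MOD 2 * b]})
        (𝓝 0) := (tendsto_inv_atTop_nhds_zero_nat (𝕜 := ℂ)).mono_left inf_le_left
    have h := ((Complex.continuous_exp.tendsto _).comp (ht.neg.mul hninv)).const_mul ω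
    rw [mul_zero, Complex.exp_zero, mul_one] at h
    exact h
  · have hre : 0 < ((Real.pi : ℂ) / b).re := by
      rw [Complex.div_natCast_re, Complex.ofReal_re]
      exact div_pos Real.pi_pos (by exact_mod_cast hb)
    filter_upwards [hz, mem_inf_of_left (eventually_gt_atTop (0 : ℕ)),
      ((Complex.continuous_re.tendsto _).comp ht).eventually_const_lt hre] with N hN hN0 hτ
    have hq1 := norm_mul_exp_lt_one hω1 hN0 hτ
    obtain ⟨k1, k2⟩ := hasDerivAt_windowH_of_deriv_normalizedWindow hb hω1 hN0 hτ hN.1 hN.2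
    have k3 := isMultipleZero_of_windowH (mul_ne_zero hω0 (Complex.exp_ne_zero _)) hq1 k1 k2
    exact ⟨k1, k2, hq1, k3, hq1, _, k3⟩
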